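/- Let $K\ge 2$. Given $N$ observations $(x_1,y_1),\dots,(x_N,y_N)$ with categories $x_i\in\{1,\dots,K\}$ and real values $y_i$ (almost surely without ties), let $N_g$ be the number of $i$ with $x_i=g$, and replace each $y_i$ by its rank in $\{1,\dots,N\}$. Let $\Pi_m$ be the set of the $\binom{N-1}{m-1}$ partitions $\mathcal I=\{i_1<\dots<i_{m-1}\}\subset\{1.5,2.5,\dots,N-0.5\}$; with $i_0=0.5$, $i_m=N+0.5$, the cells of $\mathcal I$ are $C=[i_l,i_{l+1}]$, $0\le l\le m-1$. For a cell $C$ let $o_C(g)$ be the number of observations of category $g$ whose rank lies in $C$, let $e_C(g)=(i_{l+1}-i_l)\,N_g/N$, and define $$S_m=\sum_{\mathcal I\in\Pi_m}\ \sum_{C\ \text{cell of}\ \mathcal I}\ \sum_{g=1}^K o_C(g)\log\frac{o_C(g)}{e_C(g)},\qquad 0\log 0=0 .$$ **Theorem.** Let $m=m(N)$ satisfy $m\to\infty$ and $m/N\to 0$ as $N\to\infty$. In each of the following two sampling models, $$\frac{S_m}{N\binom{N-1}{m-1}}\longrightarrow I_{XY}\quad\text{in probability as } N\to\infty,$$ where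 the mutual information $I_{XY}$ of $(X,Y)$ (the Kullback–Leibler divergence, with natural logarithm, of the joint distribution of $(X,Y)$ from the product of its marginals) is finite. (a) The observations are the first $N$ of a sequence of independent draws from a joint distribution of $(X,Y)$, where $X\in\{1,\dots,K\}$, the distribution of $Y$ has no atoms, and for every $g$ the fraction $N_g/N$ converges almost surely to a positive limit. (b) For each $N$ the categories $x_1,\dots,x_N$ (which may depend on $N$) are prescribed, with $N_g/N\to p_g>0$ for every $g$; the $y_i$ are independent, and $y_i$ has distribution $\nu_g$ if $x_i=g$, where $\nu_1,\dots,\nu_K$ are atomless probability distributions on $\mathbb R$. Here $(X,Y)$ has the joint distribution $P(X=g)=p_g$, $Y\mid X=g\sim\nu_g$. -/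

import Mathlib

open MeasureTheory ProbabilityTheory Filter Topology InformationTheory

namespace KSample

/-- The rank of the `i`-th of `N` real observations, a number in `{1, …, N}`
(distinct observations have distinct ranks). -/
noncomputable def rank {N : ℕ} (y : Fin N → ℝ) (i : Fin N) : ℕ :=
  (Finset.univ.filter (fun j => y j ≤ y i)).card

/-- `N_g`: the number of observations that belong to category `g`. -/
def groupCount {K N : ℕ} (x : Fin N → Fin K) (g : Fin K) : ℕ :=
  (Finset.univ.filter (fun i => x i = g)).card

/-- `Π_m`: the partitions of the ranks `{1, …, N}` into `m` cells. Such a partition is a set of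
`m - 1` of the cut points `1.5, 2.5, …, N - 0.5`; the number `k` in `{1, …, N - 1}` stands for the
cut point `k + 0.5`. -/
def partitions (N m : ℕ) : Finset (Finset ℕ) :=
  (Finset.Icc 1 (N - 1)).powersetCard (m - 1)

/-- The cells of a partition `I` of the ranks `{1, …, N}`. The pair `(a, b)` stands for the cell
between the cut points `a + 0.5` and `b + 0.5`, which holds the ranks `a + 1, …, b`; here `a` and
`b` are neighbours in `I ∪ {0, N}`. -/
def cells (N : ℕ) (I : Finset ℕ) : Finset (ℕ × ℕ) :=
  ((insert 0 (insert N I)) ×ˢ (insert 0 (insert N I))).filter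
    (fun c => c.1 < c.2 ∧ ∀ k ∈ I, ¬ (c.1 < k ∧ k < c.2))

/-- `o_C(g)`: the number of observations of category `g` whose rank lies in the cell `C`. -/
noncomputable def observed {K N : ℕ} (x : Fin N → Fin K) (y : Fin N → ℝ) (C : ℕ × ℕ)
    (g : Fin K) : ℕ :=
  (Finset.univ.filter (fun i => x i = g ∧ C.1 < rank y i ∧ rank y i ≤ C.2)).card

/-- `e_C(g)`: the width of the cell `C` multiplied by `N_g / N`. -/
noncomputable def expected {K N : ℕ} (x : Fin N → Fin K) (C : ℕ × ℕ) (g : Fin K) : ℝ :=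
  ((C.2 : ℝ) - (C.1 : ℝ)) * ((groupCount x g : ℝ) / (N : ℝ))

/-- The likelihood ratio score `t_C = ∑_g o_C(g) log (o_C(g) / e_C(g))` of a cell, with the usual
convention that a term with `o_C(g) = 0` is zero. -/
noncomputable def cellScore {K N : ℕ} (x : Fin N → Fin K) (y : Fin N → ℝ) (C : ℕ × ℕ) : ℝ :=
  ∑ g : Fin K, (observed x y C g : ℝ) * Real.log ((observed x y C g : ℝ) / expected x C g)

/-- The score `T^I` of a partition: the sum of the scores of its cells. -/
noncomputable def partitionScore {K N : ℕ} (x : Fin N → Fin K) (y : Fin N → ℝ)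
    (I : Finset ℕ) : ℝ :=
  ∑ C ∈ cells N I, cellScore x y C

/-- `S_m`: the sum of the scores of all partitions into `m` cells. -/
noncomputable def sumStatistic {K N : ℕ} (x : Fin N → Fin K) (y : Fin N → ℝ) (m : ℕ) : ℝ :=
  ∑ I ∈ partitions N m, partitionScore x y I

/-- The normalized statistic `S_m / (N * (N - 1).choose (m - 1))`. -/
noncomputable def estimator {K N : ℕ} (x : Fin N → Fin K) (y : Fin N → ℝ) (m : ℕ) : ℝ :=
  sumStatistic x y m / ((N : ℝ) * ((N - 1).choose (m - 1) : ℝ))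

/-- The mutual information of a joint distribution `ρ`: the Kullback-Leibler divergence (with the
natural logarithm) of `ρ` from the product of its two marginals. -/
noncomputable def mutualInfo {α β : Type*} [MeasurableSpace α] [MeasurableSpace β]
    (ρ : Measure (α × β)) : ENNReal :=
  klDiv ρ (ρ.fst.prod ρ.snd)

/-- The joint distribution of `(X, Y)` when `X = g` has probability `p g` and `Y` has the
conditional distribution `ν g` given `X = g`. -/
noncomputable def jointLaw {K : ℕ} (p : Fin K → ℝ) (ν : Fin K → Measure ℝ) :
    Measure (Fin K × ℝ) :=
  ∑ g : Fin K, ENNReal.ofReal (p g) • (Measure.dirac g).prod (ν g)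

end KSample

/-! Without ties the width of a cell is the number of observations in it. By `partitionScore_eq` the
score of a partition is then the maximal log-likelihood of the categories given their cells, minus
`∑ N_g log (N_g / N)`. The second term, divided by `N`, converges to `∑ p_g log p_g`. With `f g` the
posterior probability of category `g` and `J = ∑ p_g ∫ log f_g dν_g`, `mutualInfo_jointLaw` shows
that the mutual information is `J - ∑ p_g log p_g`. So the log-likelihood, averaged over partitions
and divided by `N`, has to converge to `J`.

Lower bound: by Gibbs' inequality (`sum_log_sub_le_condLogLik`) every positive weight depending on
the cell and the category, normalized or not, bounds the maximal log-likelihood from below.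
`exists_gibbs_approx` provides bounded weights that are almost constant between finitely many
thresholds and lose at most `ε` against `J`. Only cells with a threshold inside do damage, and since
`m → ∞` they hold a negligible share of the observations on average over partitions
(`eventually_sum_straddling_le`).

Upper bound: for fixed cells, the maximal likelihoods of all labelings add up to at most the number
of joint types (`sum_exp_condLogLik_le`), which is `exp (o(N))` because `m / N → 0`. A change of
measure to independent values from the mixture cancels the true posterior likelihood, so `exp
(condLogLik - logPosterior)` has mean at most `exp (o(N))`. Jensen's inequality passes to the
average over partitions, and Markov's inequality makes an excess of `ε N` exponentially unlikely.

The two models differ only in the law of large numbers and in this moment bound. For independent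
draws the expectation already sums over all labelings. For prescribed categories, exchangeability
under the mixture replaces that sum by an average over permutations; the price `∏ N_g! / (N! ∏ p_g ^
N_g)` is again `exp (o(N))`. Both models feed `tendstoInMeasure_estimator`. -/

namespace KSample

/-! ### Method of types and Gibbs' inequality for cell labels -/

section Types

variable {N K : ℕ} {ι : Type*} [DecidableEq ι]

/-- The number of observations with cell label `a`. -/
def cellCount (c : Fin N → ι) (a : ι) : ℕ := (Finset.univ.filter fun j => c j = a).card

/-- The number of observations with cell label `a` and category `g`. -/
def jointCount (c : Fin N → ι) (x : Fin N → Fin K) (a : ι) (g : Fin K) : ℕ :=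
  (Finset.univ.filter fun j => c j = a ∧ x j = g).card

/-- The maximal conditional log-likelihood of the categories `x` given the cell labels `c`. -/
noncomputable def condLogLik (c : Fin N → ι) (x : Fin N → Fin K) : ℝ :=
  ∑ i, Real.log ((jointCount c x (c i) (x i) : ℝ) / (cellCount c (c i) : ℝ))

lemma jointCount_pos (c : Fin N → ι) (x : Fin N → Fin K) (i : Fin N) :
    0 < jointCount c x (c i) (x i) :=
  Finset.card_pos.mpr ⟨i, by simp⟩

lemma cellCount_pos (c : Fin N → ι) (i : Fin N) : 0 < cellCount c (c i) :=
  Finset.card_pos.mpr ⟨i, by simp⟩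

lemma sum_jointCount (c : Fin N → ι) (x : Fin N → Fin K) (a : ι) :
    ∑ g, jointCount c x a g = cellCount c a := by
  unfold jointCount cellCount
  rw [Finset.card_eq_sum_card_fiberwise (f := x) (t := Finset.univ) (by simp)]
  simp [Finset.filter_filter]

lemma sum_cellCount (c : Fin N → ι) (S : Finset ι) (hc : ∀ i, c i ∈ S) :
    ∑ a ∈ S, cellCount c a = N := by
  unfold cellCount
  rw [← Finset.card_eq_sum_card_fiberwise (by simpa [Set.MapsTo] using hc)]
  simp

lemma exp_condLogLik (c : Fin N → ι) (x : Fin N → Fin K) :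
    Real.exp (condLogLik c x)
      = ∏ i, ((jointCount c x (c i) (x i) : ℝ) / (cellCount c (c i) : ℝ)) := by
  unfold condLogLik
  rw [Real.exp_sum]
  refine Finset.prod_congr rfl fun i _ => Real.exp_log ?_
  have h1 := jointCount_pos c x i
  have h2 := cellCount_pos c i
  positivity

/-- The method of types: the maximal likelihoods of all labelings add up to at most the number
of joint types. -/
lemma sum_exp_condLogLik_le (c : Fin N → ι) (S : Finset ι) (hc : ∀ i, c i ∈ S) :
    ∑ x : Fin N → Fin K, Real.exp (condLogLik c x)
      ≤ ((∏ a ∈ S, (cellCount c a + 1) ^ K : ℕ) : ℝ) := by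
  classical
  let T : Finset (S → Fin K → ℕ) :=
    Fintype.piFinset fun a : S => Fintype.piFinset fun _ : Fin K =>
      Finset.range (cellCount c a + 1)
  let τ : (Fin N → Fin K) → (S → Fin K → ℕ) := fun x a g => jointCount c x a g
  have hτ : ∀ x ∈ (Finset.univ : Finset (Fin N → Fin K)), τ x ∈ T := by
    intro x _
    simp only [T, τ, Fintype.mem_piFinset, Finset.mem_range]
    intro a g
    have := sum_jointCount c x (a : ι)
    have h2 := Finset.single_le_sum (f := fun g => jointCount c x a g) (s := Finset.univ)
      (fun _ _ => Nat.zero_le _) (Finset.mem_univ g)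
    omega
  have hT : T.card = ∏ a ∈ S, (cellCount c a + 1) ^ K := by
    simp only [T, Fintype.card_piFinset, Finset.card_range, Finset.prod_const, Finset.card_univ,
      Fintype.card_fin]
    exact Finset.prod_coe_sort S fun a => (cellCount c a + 1) ^ K
  rw [← Finset.sum_fiberwise_of_maps_to hτ, ← hT, Finset.card_eq_sum_ones]
  push_cast
  refine Finset.sum_le_sum fun t _ => ?_
  rcases Finset.eq_empty_or_nonempty (Finset.univ.filter fun x => τ x = t) with he | ⟨x₀, hx₀⟩
  · rw [he]; simp
  -- All labelings of one type are scored with the same conditional frequencies, those of `x₀`.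
  -- These define a product probability on labelings, so the whole fibre contributes at most 1.
  · have hx₀' : τ x₀ = t := by simpa using hx₀
    calc ∑ x ∈ Finset.univ.filter (fun x => τ x = t), Real.exp (condLogLik c x)
        = ∑ x ∈ Finset.univ.filter (fun x => τ x = t),
            ∏ i, ((jointCount c x₀ (c i) (x i) : ℝ) / (cellCount c (c i) : ℝ)) := by
          refine Finset.sum_congr rfl fun x hx => ?_
          rw [exp_condLogLik]
          refine Finset.prod_congr rfl fun i _ => ?_
          have : τ x = τ x₀ := by rw [hx₀']; simpa using hx
          have := congrFun (congrFun this ⟨c i, hc i⟩) (x i)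
          simp only [τ] at this
          rw [this]
      _ ≤ ∑ x : Fin N → Fin K,
            ∏ i, ((jointCount c x₀ (c i) (x i) : ℝ) / (cellCount c (c i) : ℝ)) :=
          Finset.sum_le_sum_of_subset_of_nonneg (Finset.filter_subset _ _)
            fun x _ _ => Finset.prod_nonneg fun i _ => by positivity
      _ = ∏ i : Fin N, ∑ g : Fin K,
            ((jointCount c x₀ (c i) g : ℝ) / (cellCount c (c i) : ℝ)) := by
          rw [Finset.prod_univ_sum]; simp
      _ = 1 := by
          refine Finset.prod_eq_one fun i _ => ?_
          rw [← Finset.sum_div, ← Nat.cast_sum, sum_jointCount]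
          exact div_self (by have := cellCount_pos c i; positivity)

/-- Trades the logarithm for a small slope and a constant. Summed over at most `m` cells with `N`
observations it costs `δ N + m log (1 / δ)`, which is `o(N)` as `δ → 0` after `m / N → 0`. -/
lemma log_one_add_le {δ : ℝ} (hδ : 0 < δ) (hδ1 : δ ≤ 1) {x : ℝ} (hx : 0 ≤ x) :
    Real.log (x + 1) ≤ δ * x + Real.log (1 / δ) := by
  have h : x + 1 ≤ (δ * x + 1) * (1 / δ) := by
    have : (1:ℝ) ≤ 1 / δ := by rw [le_div_iff₀ hδ]; linarith
    calc x + 1 ≤ x + 1 / δ := by linarith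
      _ = (δ * x + 1) * (1 / δ) := by field_simp
  calc Real.log (x + 1) ≤ Real.log ((δ * x + 1) * (1 / δ)) := Real.log_le_log (by linarith) h
    _ = Real.log (δ * x + 1) + Real.log (1 / δ) :=
        Real.log_mul (by positivity) (by positivity)
    _ ≤ δ * x + Real.log (1 / δ) := by
        have := Real.log_le_sub_one_of_pos (x := δ * x + 1) (by positivity)
        linarith

lemma sum_exp_condLogLik_le_exp (c : Fin N → ι) (S : Finset ι) (hc : ∀ i, c i ∈ S)
    {δ : ℝ} (hδ : 0 < δ) (hδ1 : δ ≤ 1) {m : ℕ} (hS : S.card ≤ m) :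
    ∑ x : Fin N → Fin K, Real.exp (condLogLik c x)
      ≤ Real.exp (K * (δ * N + m * Real.log (1 / δ))) := by
  refine (sum_exp_condLogLik_le c S hc).trans ?_
  push_cast
  have h1 : ∏ a ∈ S, ((cellCount c a : ℝ) + 1) ^ K
      = Real.exp (K * ∑ a ∈ S, Real.log ((cellCount c a : ℝ) + 1)) := by
    rw [Finset.mul_sum, Real.exp_sum]
    refine Finset.prod_congr rfl fun a _ => ?_
    rw [Real.exp_nat_mul, Real.exp_log (by positivity)]
  rw [h1]
  refine Real.exp_le_exp.mpr (mul_le_mul_of_nonneg_left ?_ (by positivity))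
  calc ∑ a ∈ S, Real.log ((cellCount c a : ℝ) + 1)
      ≤ ∑ a ∈ S, (δ * cellCount c a + Real.log (1 / δ)) :=
        Finset.sum_le_sum fun a _ => log_one_add_le hδ hδ1 (by positivity)
    _ = δ * N + S.card * Real.log (1 / δ) := by
        rw [Finset.sum_add_distrib, ← Finset.mul_sum, ← Nat.cast_sum, sum_cellCount c S hc]
        simp
    _ ≤ δ * N + m * Real.log (1 / δ) := by
        have : 0 ≤ Real.log (1 / δ) := Real.log_nonneg (by rw [le_div_iff₀ hδ]; linarith)
        gcongr

/-- The likelihood sees only counts. This invariance drives the exchangeability argument for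
prescribed categories. -/
lemma condLogLik_comp_perm (c : Fin N → ι) (x : Fin N → Fin K) (σ : Equiv.Perm (Fin N)) :
    condLogLik (c ∘ σ) (x ∘ σ) = condLogLik c x := by
  have h1 : ∀ a g, jointCount (c ∘ σ) (x ∘ σ) a g = jointCount c x a g := fun a g => by
    unfold jointCount
    refine Finset.card_bij (fun i _ => σ i) (by simp) (by simp) ?_
    intro b hb
    exact ⟨σ.symm b, by simpa using hb, by simp⟩
  have h2 : ∀ a, cellCount (c ∘ σ) a = cellCount c a := fun a => by
    unfold cellCount
    refine Finset.card_bij (fun i _ => σ i) (by simp) (by simp) ?_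
    intro b hb
    exact ⟨σ.symm b, by simpa using hb, by simp⟩
  unfold condLogLik
  simp only [h1, h2, Function.comp_apply]
  exact Equiv.sum_comp σ
    (fun i => Real.log ((jointCount c x (c i) (x i) : ℝ) / (cellCount c (c i) : ℝ)))

/-- Gibbs' inequality, in the form without normalization. -/
lemma sum_log_sub_le_condLogLik (c : Fin N → ι) (x : Fin N → Fin K) (Q : ι → Fin K → ℝ)
    (hQ : ∀ a g, 0 < Q a g) :
    ∑ i, (Real.log (Q (c i) (x i)) - ∑ g, Q (c i) g + 1) ≤ condLogLik c x := by
  classical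
  set r : Fin N → Fin K → ℝ :=
    fun i g => (jointCount c x (c i) g : ℝ) / (cellCount c (c i) : ℝ) with hr
  have key : ∀ i, Real.log (Q (c i) (x i)) - Q (c i) (x i) / r i (x i) + 1
      ≤ Real.log (r i (x i)) := by
    -- This is `log u ≤ u - 1` at `u = Q / r`, the ratio of the weight to the empirical frequency.
    intro i
    have h1 := jointCount_pos c x i
    have h2 := cellCount_pos c i
    have hpos : 0 < r i (x i) := by simp only [hr]; positivity
    have := Real.log_le_sub_one_of_pos (div_pos (hQ (c i) (x i)) hpos)
    rw [Real.log_div (hQ _ _).ne' hpos.ne'] at this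
    linarith
  -- Within a cell, the observations of category `g` contribute their number times `Q / r`, which is
  -- the cell count times `Q`. Categories absent from the cell contribute nothing on the left, hence
  -- only an inequality.
  have hsum : ∑ i, Q (c i) (x i) / r i (x i) ≤ ∑ i, ∑ g, Q (c i) g := by
    let S := Finset.univ.image c
    have hc : ∀ i ∈ Finset.univ, c i ∈ S := fun i _ => Finset.mem_image_of_mem _ (Finset.mem_univ i)
    rw [← Finset.sum_fiberwise_of_maps_to hc, ← Finset.sum_fiberwise_of_maps_to hc]
    refine Finset.sum_le_sum fun a _ => ?_
    have e2 : ∑ i with c i = a, ∑ g, Q (c i) g = ∑ g, (cellCount c a : ℝ) * Q a g := by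
      rw [← Finset.mul_sum]
      rw [Finset.sum_congr rfl (g := fun _ => ∑ g, Q a g)
        (fun i hi => by rw [(Finset.mem_filter.mp hi).2])]
      simp [cellCount]
    have e1 : ∑ i with c i = a, Q (c i) (x i) / r i (x i)
        = ∑ g, ∑ i with c i = a ∧ x i = g, Q a g / (jointCount c x a g / cellCount c a) := by
      rw [← Finset.sum_fiberwise_of_maps_to (t := Finset.univ) (g := x) (by simp)]
      refine Finset.sum_congr rfl fun g _ => ?_
      rw [Finset.filter_filter]
      refine Finset.sum_congr rfl fun i hi => ?_
      obtain ⟨rfl, rfl⟩ := (Finset.mem_filter.mp hi).2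
      rfl
    rw [e1, e2]
    refine Finset.sum_le_sum fun g _ => ?_
    rw [Finset.sum_const, nsmul_eq_mul]
    change (jointCount c x a g : ℝ) * _ ≤ _
    rcases Nat.eq_zero_or_pos (jointCount c x a g) with h0 | h0
    · rw [h0]; simp only [Nat.cast_zero, zero_mul]
      have := (hQ a g).le
      positivity
    · have : (jointCount c x a g : ℝ) ≠ 0 := by positivity
      refine le_of_eq ?_
      rw [div_div_eq_mul_div]
      field_simp
  calc ∑ i, (Real.log (Q (c i) (x i)) - ∑ g, Q (c i) g + 1)
      ≤ ∑ i, (Real.log (Q (c i) (x i)) - Q (c i) (x i) / r i (x i) + 1) := by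
        simp only [Finset.sum_add_distrib, Finset.sum_sub_distrib]
        linarith
    _ ≤ condLogLik c x := Finset.sum_le_sum fun i _ => key i

end Types

/-! ### Ranks of distinct observations -/

section Rank

variable {N : ℕ} {y : Fin N → ℝ}

lemma rank_pos (y : Fin N → ℝ) (i : Fin N) : 1 ≤ rank y i :=
  Finset.card_pos.mpr ⟨i, by simp⟩

lemma rank_le (y : Fin N → ℝ) (i : Fin N) : rank y i ≤ N := by
  simpa [rank] using Finset.card_filter_le (Finset.univ : Finset (Fin N)) (fun j => y j ≤ y i)

lemma rank_lt_rank {i j : Fin N} (h : y i < y j) : rank y i < rank y j := by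
  refine Finset.card_lt_card ⟨fun k hk => ?_, fun hk => ?_⟩
  · simp only [Finset.mem_filter, Finset.mem_univ, true_and] at hk ⊢
    exact hk.trans h.le
  · have := hk (show j ∈ _ by simp)
    simp only [Finset.mem_filter, Finset.mem_univ, true_and] at this
    exact absurd this (not_le.mpr h)

lemma rank_injective (hy : Function.Injective y) : Function.Injective (rank y) := by
  intro i j h
  by_contra hij
  rcases lt_or_gt_of_ne (hy.ne hij) with h1 | h1
  · exact (rank_lt_rank h1).ne h
  · exact (rank_lt_rank h1).ne' h

lemma image_rank (hy : Function.Injective y) : Finset.univ.image (rank y) = Finset.Icc 1 N := by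
  refine Finset.eq_of_subset_of_card_le ?_ ?_
  · intro k hk
    obtain ⟨i, -, rfl⟩ := Finset.mem_image.mp hk
    exact Finset.mem_Icc.mpr ⟨rank_pos y i, rank_le y i⟩
  · rw [Finset.card_image_of_injective _ (rank_injective hy)]
    simp

lemma card_rank_mem (hy : Function.Injective y) {a b : ℕ} (hb : b ≤ N) :
    (Finset.univ.filter fun i => a < rank y i ∧ rank y i ≤ b).card = b - a := by
  rw [← Finset.card_image_of_injective _ (rank_injective hy)]
  have : (Finset.univ.filter fun i => a < rank y i ∧ rank y i ≤ b).image (rank y)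
      = Finset.Ioc a b := by
    ext k
    simp only [Finset.mem_image, Finset.mem_filter, Finset.mem_univ, true_and, Finset.mem_Ioc]
    constructor
    · rintro ⟨i, h, rfl⟩; exact h
    · intro h
      have : k ∈ Finset.univ.image (rank y) := by
        rw [image_rank hy]; exact Finset.mem_Icc.mpr ⟨by omega, by omega⟩
      obtain ⟨i, -, rfl⟩ := Finset.mem_image.mp this
      exact ⟨i, h, rfl⟩
  rw [this, Nat.card_Ioc]

lemma rank_comp_perm (y : Fin N → ℝ) (σ : Equiv.Perm (Fin N)) (i : Fin N) :
    rank (y ∘ σ) i = rank y (σ i) := by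
  unfold rank
  refine Finset.card_bij (fun i _ => σ i) (by simp) (by simp) ?_
  intro b hb
  exact ⟨σ.symm b, by simpa using hb, by simp⟩

end Rank

/-! ### Cells of a partition as labels of the observations -/

section Cells

variable {N m : ℕ} {I : Finset ℕ}

lemma mem_cells {C : ℕ × ℕ} : C ∈ cells N I ↔ ((C.1 = 0 ∨ C.1 = N ∨ C.1 ∈ I) ∧
    (C.2 = 0 ∨ C.2 = N ∨ C.2 ∈ I)) ∧ C.1 < C.2 ∧ ∀ k ∈ I, ¬ (C.1 < k ∧ k < C.2) := by
  simp [cells]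

lemma bounds_of_mem (hI : I ⊆ Finset.Icc 1 (N - 1)) {k : ℕ} (hk : k ∈ I) : 1 ≤ k ∧ k < N := by
  have := Finset.mem_Icc.mp (hI hk); omega

lemma snd_le_of_mem_cells (hI : I ⊆ Finset.Icc 1 (N - 1)) {C : ℕ × ℕ} (hC : C ∈ cells N I) :
    C.2 ≤ N := by
  rcases (mem_cells.mp hC).1.2 with h | h | h
  · omega
  · omega
  · exact (bounds_of_mem hI h).2.le

/-- If the endpoints differed, one of them would be a cut point strictly inside the other cell; the
outer endpoints `0` and `N` cannot lie inside a cell. -/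
lemma cells_eq_of_overlap (hI : I ⊆ Finset.Icc 1 (N - 1)) {C D : ℕ × ℕ} (hC : C ∈ cells N I)
    (hD : D ∈ cells N I) (h1 : C.1 < D.2) (h2 : D.1 < C.2) : C = D := by
  have hC2 := snd_le_of_mem_cells hI hC
  have hD2 := snd_le_of_mem_cells hI hD
  obtain ⟨⟨c1, c2⟩, c3, c4⟩ := mem_cells.mp hC
  obtain ⟨⟨d1, d2⟩, d3, d4⟩ := mem_cells.mp hD
  refine Prod.ext ?_ ?_
  · rcases lt_trichotomy C.1 D.1 with h | h | h
    · rcases d1 with d | d | d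
      · omega
      · omega
      · exact absurd ⟨h, h2⟩ (c4 _ d)
    · exact h
    · rcases c1 with d | d | d
      · omega
      · omega
      · exact absurd ⟨h, h1⟩ (d4 _ d)
  · rcases lt_trichotomy C.2 D.2 with h | h | h
    · rcases c2 with d | d | d
      · omega
      · omega
      · exact absurd ⟨h2, h⟩ (d4 _ d)
    · exact h
    · rcases d2 with d | d | d
      · omega
      · omega
      · exact absurd ⟨h1, h⟩ (c4 _ d)

lemma exists_cell (I : Finset ℕ) {k : ℕ} (hk : 1 ≤ k) (hkN : k ≤ N) :
    ∃ C ∈ cells N I, C.1 < k ∧ k ≤ C.2 := by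
  classical
  -- The cell around `k` runs from the last cut below `k` to the first cut at or above `k`; the
  -- right endpoint belongs to the cell.
  obtain ⟨a, ha, ha'⟩ := Finset.exists_max_image ((insert 0 I).filter (· < k)) id
    ⟨0, by simp; omega⟩
  obtain ⟨b, hb, hb'⟩ := Finset.exists_min_image ((insert N I).filter (k ≤ ·)) id
    ⟨N, by simp; omega⟩
  simp only [Finset.mem_filter, Finset.mem_insert, id] at ha hb ha' hb'
  refine ⟨(a, b), mem_cells.mpr ⟨⟨by tauto, by tauto⟩, lt_of_lt_of_le ha.2 hb.2, ?_⟩, ha.2, hb.2⟩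
  rintro j hj ⟨h1, h2⟩
  rcases lt_or_ge j k with h | h
  · exact absurd (ha' j ⟨Or.inr hj, h⟩) (by simp only at h1; omega)
  · exact absurd (hb' j ⟨Or.inr hj, h⟩) (by simp only at h2; omega)

/-- A cell is determined by its right endpoint, which is `N` or a cut. -/
lemma card_cells_le (hI : I ⊆ Finset.Icc 1 (N - 1)) : (cells N I).card ≤ I.card + 1 := by
  refine le_trans ?_ (Finset.card_insert_le N I)
  refine Finset.card_le_card_of_injOn Prod.snd ?_ ?_
  · intro C hC
    have hC' := mem_cells.mp (Finset.mem_coe.mp hC)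
    have := hC'.1.2
    simp only [Finset.coe_insert, Set.mem_insert_iff, Finset.mem_coe]
    rcases this with h | h | h
    · omega
    · exact Or.inl h
    · exact Or.inr h
  · intro C hC D hD h
    have hC' := (mem_cells.mp (Finset.mem_coe.mp hC)).2.1
    have hD' := (mem_cells.mp (Finset.mem_coe.mp hD)).2.1
    exact cells_eq_of_overlap hI hC hD (by omega) (by omega)

open Classical in
/-- The cell of the partition `I` that holds the rank `k`. -/
noncomputable def cellOf (N : ℕ) (I : Finset ℕ) (k : ℕ) : ℕ × ℕ :=
  if h : ∃ C ∈ cells N I, C.1 < k ∧ k ≤ C.2 then h.choose else (0, 0)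

lemma cellOf_spec (I : Finset ℕ) {k : ℕ} (hk : 1 ≤ k) (hkN : k ≤ N) :
    cellOf N I k ∈ cells N I ∧ (cellOf N I k).1 < k ∧ k ≤ (cellOf N I k).2 := by
  have h := exists_cell I hk hkN
  unfold cellOf
  rw [dif_pos h]
  exact h.choose_spec

lemma cellOf_eq_iff (hI : I ⊆ Finset.Icc 1 (N - 1)) {k : ℕ} (hk : 1 ≤ k) (hkN : k ≤ N)
    {C : ℕ × ℕ} (hC : C ∈ cells N I) : cellOf N I k = C ↔ C.1 < k ∧ k ≤ C.2 := by
  obtain ⟨h1, h2, h3⟩ := cellOf_spec I hk hkN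
  constructor
  · rintro rfl; exact ⟨h2, h3⟩
  · rintro ⟨h4, h5⟩
    exact cells_eq_of_overlap hI h1 hC (by omega) (by omega)

lemma subset_of_mem_partitions (h : I ∈ partitions N m) : I ⊆ Finset.Icc 1 (N - 1) :=
  (Finset.mem_powersetCard.mp h).1

lemma card_partitions (N m : ℕ) : (partitions N m).card = (N - 1).choose (m - 1) := by
  simp [partitions, Finset.card_powersetCard]

lemma card_cells_le_of_mem_partitions (hm : 1 ≤ m) (h : I ∈ partitions N m) :
    (cells N I).card ≤ m := by
  have h1 := card_cells_le (subset_of_mem_partitions h)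
  have h2 := (Finset.mem_powersetCard.mp h).2
  omega

/-- The cells of the observations. -/
noncomputable def cellLabel (I : Finset ℕ) (y : Fin N → ℝ) (i : Fin N) : ℕ × ℕ :=
  cellOf N I (rank y i)

lemma cellLabel_mem (I : Finset ℕ) (y : Fin N → ℝ) (i : Fin N) :
    cellLabel I y i ∈ cells N I :=
  (cellOf_spec I (rank_pos y i) (rank_le y i)).1

lemma cellLabel_eq_iff (hI : I ⊆ Finset.Icc 1 (N - 1)) (y : Fin N → ℝ) (i : Fin N)
    {C : ℕ × ℕ} (hC : C ∈ cells N I) :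
    cellLabel I y i = C ↔ C.1 < rank y i ∧ rank y i ≤ C.2 :=
  cellOf_eq_iff hI (rank_pos y i) (rank_le y i) hC

lemma cellLabel_comp_perm (I : Finset ℕ) (y : Fin N → ℝ) (σ : Equiv.Perm (Fin N)) :
    cellLabel I (y ∘ σ) = cellLabel I y ∘ σ := by
  ext1 i
  simp [cellLabel, rank_comp_perm]

lemma cellCount_cellLabel (hI : I ⊆ Finset.Icc 1 (N - 1)) {y : Fin N → ℝ}
    (hy : Function.Injective y) {C : ℕ × ℕ} (hC : C ∈ cells N I) :
    cellCount (cellLabel I y) C = C.2 - C.1 := by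
  rw [← card_rank_mem hy (snd_le_of_mem_cells hI hC)]
  unfold cellCount
  congr 1
  ext i
  simp [cellLabel_eq_iff hI y i hC]

end Cells

/-! ### The statistic as an averaged log-likelihood -/

section Score

variable {K N m : ℕ} {I : Finset ℕ}

lemma sum_jointCount_mul {ι : Type*} [DecidableEq ι] (c : Fin N → ι) (x : Fin N → Fin K)
    (S : Finset ι) (hc : ∀ i, c i ∈ S) (F : ι → Fin K → ℝ) :
    ∑ a ∈ S, ∑ g, (jointCount c x a g : ℝ) * F a g = ∑ i, F (c i) (x i) := by
  rw [← Finset.sum_fiberwise_of_maps_to (g := c) (t := S) (fun i _ => hc i)]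
  refine Finset.sum_congr rfl fun a _ => ?_
  rw [← Finset.sum_fiberwise_of_maps_to (g := x) (t := Finset.univ) (fun i _ => Finset.mem_univ _)]
  refine Finset.sum_congr rfl fun g _ => ?_
  rw [Finset.filter_filter, jointCount, ← nsmul_eq_mul, ← Finset.sum_const]
  refine Finset.sum_congr rfl fun i hi => ?_
  obtain ⟨rfl, rfl⟩ := (Finset.mem_filter.mp hi).2
  rfl

lemma sum_groupCount_mul (x : Fin N → Fin K) (F : Fin K → ℝ) :
    ∑ g, (groupCount x g : ℝ) * F g = ∑ i, F (x i) := by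
  rw [← Finset.sum_fiberwise_of_maps_to (g := x) (t := Finset.univ) (fun i _ => Finset.mem_univ _)]
  refine Finset.sum_congr rfl fun g _ => ?_
  rw [groupCount, ← nsmul_eq_mul, ← Finset.sum_const]
  refine Finset.sum_congr rfl fun i hi => ?_
  rw [(Finset.mem_filter.mp hi).2]

/-- Since `e_C(g)` is the cell count times `N_g / N`, each logarithm splits into a conditional
frequency and a marginal one, and the marginal part no longer depends on the partition. -/
lemma partitionScore_eq (x : Fin N → Fin K) {y : Fin N → ℝ} (hy : Function.Injective y)
    (hI : I ⊆ Finset.Icc 1 (N - 1)) :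
    partitionScore x y I = condLogLik (cellLabel I y) x
      - ∑ g, (groupCount x g : ℝ) * Real.log (groupCount x g / N) := by
  have hmem := cellLabel_mem I y
  unfold condLogLik
  rw [sum_groupCount_mul x fun g => Real.log (groupCount x g / N),
    ← sum_jointCount_mul (cellLabel I y) x (cells N I) hmem
      (fun a g => Real.log ((jointCount (cellLabel I y) x a g : ℝ)
        / (cellCount (cellLabel I y) a : ℝ))),
    ← sum_jointCount_mul (cellLabel I y) x (cells N I) hmem
      (fun a g => Real.log ((groupCount x g : ℝ) / N)),
    ← Finset.sum_sub_distrib]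
  refine Finset.sum_congr rfl fun C hC => ?_
  rw [cellScore, ← Finset.sum_sub_distrib]
  refine Finset.sum_congr rfl fun g _ => ?_
  have hobs : observed x y C g = jointCount (cellLabel I y) x C g := by
    unfold observed jointCount
    congr 1
    ext i
    simp only [Finset.mem_filter, Finset.mem_univ, true_and, cellLabel_eq_iff hI y i hC]
    tauto
  rw [hobs]
  rcases Nat.eq_zero_or_pos (jointCount (cellLabel I y) x C g) with h0 | h0
  · simp [h0]
  · obtain ⟨i, hi⟩ := Finset.card_pos.mp h0
    obtain ⟨h1, h2⟩ := (Finset.mem_filter.mp hi).2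
    have hcc : 0 < cellCount (cellLabel I y) C := h1 ▸ cellCount_pos _ i
    have hg : 0 < groupCount x g := Finset.card_pos.mpr ⟨i, by simp [h2]⟩
    have hN : 0 < N := i.pos
    have he : expected x C g
        = (cellCount (cellLabel I y) C : ℝ) * ((groupCount x g : ℝ) / N) := by
      rw [cellCount_cellLabel hI hy hC, expected, Nat.cast_sub (mem_cells.mp hC).2.1.le]
    have a1 : (0:ℝ) < jointCount (cellLabel I y) x C g := by positivity
    have a2 : (0:ℝ) < cellCount (cellLabel I y) C := by positivity
    have a3 : (0:ℝ) < (groupCount x g : ℝ) / N := by positivity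
    rw [he, Real.log_div a1.ne' (by positivity), Real.log_mul a2.ne' a3.ne',
      Real.log_div a1.ne' a2.ne']
    ring

/-- The conditional log-likelihood, averaged over all partitions. -/
noncomputable def avgLogLik (m : ℕ) (x : Fin N → Fin K) (y : Fin N → ℝ) : ℝ :=
  (∑ I ∈ partitions N m, condLogLik (cellLabel I y) x) / ((N - 1).choose (m - 1) : ℝ)

lemma estimator_eq (x : Fin N → Fin K) {y : Fin N → ℝ} (hy : Function.Injective y)
    (hmN : m ≤ N) (hN : 1 ≤ N) :
    estimator x y m = avgLogLik m x y / N
      - ∑ g, (groupCount x g / N : ℝ) * Real.log (groupCount x g / N) := by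
  have hch : (0:ℝ) < ((N - 1).choose (m - 1) : ℝ) := by
    exact_mod_cast Nat.choose_pos (by omega)
  have hN' : (0:ℝ) < N := by exact_mod_cast hN
  unfold estimator sumStatistic avgLogLik
  rw [Finset.sum_congr rfl fun I hI => partitionScore_eq x hy (subset_of_mem_partitions hI),
    Finset.sum_sub_distrib, Finset.sum_const, card_partitions, nsmul_eq_mul]
  have : ∑ g, (groupCount x g / N : ℝ) * Real.log (groupCount x g / N)
      = (∑ g, (groupCount x g : ℝ) * Real.log (groupCount x g / N)) / N := by
    rw [Finset.sum_div]
    exact Finset.sum_congr rfl fun g _ => by ring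
  rw [this]
  field_simp

end Score

/-! ### Mean width of the cell around a fixed cut point -/

section Straddle

variable {K N m : ℕ} {I : Finset ℕ}

/-- The cells of `I` that have the cut point `a + 0.5` in their interior (at most one). -/
def straddling (N : ℕ) (I : Finset ℕ) (a : ℕ) : Finset (ℕ × ℕ) :=
  (cells N I).filter fun C => C.1 < a ∧ a < C.2

lemma card_disjoint_le {B : Finset ℕ} (hB : B ⊆ Finset.Icc 1 (N - 1)) :
    ((partitions N m).filter fun I => Disjoint I B).card
      ≤ (N - 1 - B.card).choose (m - 1) := by
  have : ((partitions N m).filter fun I => Disjoint I B)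
      ⊆ (Finset.Icc 1 (N - 1) \ B).powersetCard (m - 1) := by
    intro I hI
    obtain ⟨h1, h2⟩ := Finset.mem_filter.mp hI
    obtain ⟨h3, h4⟩ := Finset.mem_powersetCard.mp h1
    exact Finset.mem_powersetCard.mpr ⟨Finset.subset_sdiff.mpr ⟨h3, h2⟩, h4⟩
  refine (Finset.card_le_card this).trans ?_
  rw [Finset.card_powersetCard, Finset.card_sdiff_of_subset hB]
  simp

/-- A cell around `a` either stays within distance `w` on both sides, so its width is at most `2 w`,
or leaves `w` consecutive cut positions on one side of `a` empty. Partitions of the second kind are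
counted by `card_disjoint_le`, and their width is at most `N`. -/
lemma sum_straddling_le (a w : ℕ) :
    ∑ I ∈ partitions N m, ∑ C ∈ straddling N I a, (C.2 - C.1)
      ≤ (N - 1).choose (m - 1) * (2 * w) + 2 * N * (N - 1 - w).choose (m - 1) := by
  classical
  let B₁ := Finset.Icc (a + 1) (a + w)
  let B₂ := Finset.Ico (a - w) a
  let A₁ := (partitions N m).filter fun I => a + w ≤ N - 1 ∧ Disjoint I B₁
  let A₂ := (partitions N m).filter fun I => w < a ∧ a ≤ N ∧ Disjoint I B₂
  have h1 : ∀ I ∈ partitions N m, ∑ C ∈ straddling N I a, (C.2 - C.1)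
      ≤ 2 * w + ((if a + w ≤ N - 1 ∧ Disjoint I B₁ then N else 0)
        + (if w < a ∧ a ≤ N ∧ Disjoint I B₂ then N else 0)) := by
    intro I hI
    have hI' := subset_of_mem_partitions hI
    rcases Finset.eq_empty_or_nonempty (straddling N I a) with h0 | ⟨C, hC⟩
    · rw [h0]; simp
    · have huniq : straddling N I a = {C} := by
        refine Finset.eq_singleton_iff_unique_mem.mpr ⟨hC, fun D hD => ?_⟩
        obtain ⟨hC1, hC2, hC3⟩ := Finset.mem_filter.mp hC
        obtain ⟨hD1, hD2, hD3⟩ := Finset.mem_filter.mp hD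
        exact cells_eq_of_overlap hI' hD1 hC1 (by omega) (by omega)
      rw [huniq, Finset.sum_singleton]
      obtain ⟨hC1, hC2, hC3⟩ := Finset.mem_filter.mp hC
      have hle := snd_le_of_mem_cells hI' hC1
      have hgap := (mem_cells.mp hC1).2.2
      by_cases c1 : a + w < C.2
      · have : a + w ≤ N - 1 ∧ Disjoint I B₁ := by
          refine ⟨by omega, Finset.disjoint_left.mpr fun k hk hk' => hgap k hk ?_⟩
          have := Finset.mem_Icc.mp hk'; omega
        rw [if_pos this]; omega
      · by_cases c2 : C.1 + w < a
        · have : w < a ∧ a ≤ N ∧ Disjoint I B₂ := by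
            refine ⟨by omega, by omega, Finset.disjoint_left.mpr fun k hk hk' => hgap k hk ?_⟩
            have := Finset.mem_Ico.mp hk'; omega
          rw [if_pos this]; omega
        · omega
  have hA₁ : A₁.card ≤ (N - 1 - w).choose (m - 1) := by
    by_cases h : a + w ≤ N - 1
    · have hB : B₁ ⊆ Finset.Icc 1 (N - 1) := by
        intro k hk; simp only [B₁, Finset.mem_Icc] at hk ⊢; omega
      have := card_disjoint_le (m := m) hB
      simp only [B₁, Nat.card_Icc] at this
      refine le_trans (Finset.card_le_card ?_) (this.trans (le_of_eq (by congr 1; omega)))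
      intro I hI
      simp only [A₁, Finset.mem_filter] at hI ⊢
      exact ⟨hI.1, hI.2.2⟩
    · simp [A₁, h]
  have hA₂ : A₂.card ≤ (N - 1 - w).choose (m - 1) := by
    by_cases h : w < a ∧ a ≤ N
    · have hB : B₂ ⊆ Finset.Icc 1 (N - 1) := by
        intro k hk; simp only [B₂, Finset.mem_Icc, Finset.mem_Ico] at hk ⊢; omega
      have := card_disjoint_le (m := m) hB
      simp only [B₂, Nat.card_Ico] at this
      refine le_trans (Finset.card_le_card ?_) (this.trans (le_of_eq (by congr 1; omega)))
      intro I hI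
      simp only [A₂, Finset.mem_filter] at hI ⊢
      exact ⟨hI.1, hI.2.2.2⟩
    · have : A₂ = ∅ := by
        refine Finset.filter_eq_empty_iff.mpr fun I _ h' => h ⟨h'.1, h'.2.1⟩
      simp [this]
  refine (Finset.sum_le_sum h1).trans ?_
  rw [Finset.sum_add_distrib, Finset.sum_const, card_partitions, Finset.sum_add_distrib,
    ← Finset.sum_filter, ← Finset.sum_filter, Finset.sum_const, Finset.sum_const]
  simp only [smul_eq_mul]
  have e1 := Nat.mul_le_mul_right N hA₁
  have e2 := Nat.mul_le_mul_right N hA₂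
  simp only [A₁, A₂] at e1 e2
  nlinarith

/-- Compare falling factorials factor by factor: `(M - b - j) / (M - j) ≤ (M - b) / M`. -/
lemma choose_sub_le (M b k : ℕ) (hM : 0 < M) (hb : b ≤ M) :
    ((M - b).choose k : ℝ) ≤ M.choose k * (1 - b / M : ℝ) ^ k := by
  have hM' : (0:ℝ) < M := by exact_mod_cast hM
  have key : ∀ k, (M - b).descFactorial k * M ^ k ≤ M.descFactorial k * (M - b) ^ k := by
    intro k
    induction k with
    | zero => simp
    | succ k ih =>
      rw [Nat.descFactorial_succ, Nat.descFactorial_succ, pow_succ, pow_succ]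
      have h : (M - b - k) * M ≤ (M - k) * (M - b) := by
        rcases Nat.lt_or_ge (M - b) k with h | h
        · rw [Nat.sub_eq_zero_of_le h.le]; simp
        · obtain ⟨d, hd⟩ := Nat.exists_eq_add_of_le hb
          obtain ⟨e, he⟩ := Nat.exists_eq_add_of_le h
          have : M = b + k + e := by omega
          have e1 : M - b - k = e := by omega
          have e2 : M - k = b + e := by omega
          have e3 : M - b = k + e := by omega
          rw [e1, e2, e3, this]; nlinarith [Nat.zero_le (b * k)]
      calc (M - b - k) * (M - b).descFactorial k * (M ^ k * M)
          = ((M - b).descFactorial k * M ^ k) * ((M - b - k) * M) := by ring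
        _ ≤ (M.descFactorial k * (M - b) ^ k) * ((M - k) * (M - b)) := Nat.mul_le_mul ih h
        _ = _ := by ring
  have h1 := key k
  rw [Nat.descFactorial_eq_factorial_mul_choose, Nat.descFactorial_eq_factorial_mul_choose,
    mul_assoc, mul_assoc] at h1
  have h2 := Nat.le_of_mul_le_mul_left h1 (Nat.factorial_pos k)
  have h3 : ((M - b).choose k : ℝ) * (M:ℝ) ^ k ≤ M.choose k * ((M:ℝ) - b) ^ k := by
    have := (Nat.cast_le (α := ℝ)).mpr h2
    push_cast [Nat.cast_sub hb] at this
    exact this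
  have : (1 - b / M : ℝ) = (M - b) / M := by field_simp
  rw [this, div_pow, mul_div_assoc', le_div_iff₀ (by positivity)]
  exact h3

/-- The mean width of the cell around a given cut point is a negligible part of `N`. -/
lemma eventually_sum_straddling_le (m : ℕ → ℕ) (hm : Tendsto m atTop atTop) {δ : ℝ} (hδ : 0 < δ) :
    ∀ᶠ N in atTop, ∀ a : ℕ,
      ((∑ I ∈ partitions N (m N), ∑ C ∈ straddling N I a, (C.2 - C.1) : ℕ) : ℝ)
        ≤ δ * N * ((N - 1).choose (m N - 1) : ℝ) := by
  wlog hδ1 : δ ≤ 1 generalizing δ with H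
  · filter_upwards [H one_pos le_rfl] with N hN a
    refine (hN a).trans ?_
    have : (1:ℝ) ≤ δ := (not_le.mp hδ1).le
    gcongr
  have hpow : Tendsto (fun N => (1 - δ / 8 : ℝ) ^ (m N - 1)) atTop (𝓝 0) :=
    (tendsto_pow_atTop_nhds_zero_of_lt_one (by linarith) (by linarith)).comp
      ((tendsto_sub_atTop_nat 1).comp hm)
  filter_upwards [hpow.eventually (gt_mem_nhds (show 0 < δ / 8 by positivity)),
    eventually_ge_atTop (2 + ⌈8 / δ⌉₊)] with N hN hN2 a
  have hN3 : 8 / δ ≤ N := (Nat.le_ceil _).trans (by exact_mod_cast (by omega))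
  have hN4 : 8 ≤ δ * N := by rw [div_le_iff₀ hδ] at hN3; linarith
  -- With this `w`, short cells contribute at most `2 w ≤ δ N / 2` on average. Long cells have
  -- relative frequency at most `2 (1 - δ / 8) ^ (m - 1)`, eventually below `δ / 4`; this is where
  -- `m → ∞` enters.
  set w := ⌈δ / 8 * N⌉₊ with hw
  have hw1 : δ / 8 * N ≤ w := Nat.le_ceil _
  have hw2 : (w:ℝ) ≤ δ / 4 * N := by
    have := Nat.ceil_lt_add_one (show 0 ≤ δ / 8 * (N:ℝ) by positivity)
    rw [← hw] at this; linarith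
  have hwN : w ≤ N - 1 := by
    have h1 : (w:ℝ) ≤ 1 / 4 * N := hw2.trans (by gcongr)
    have h2 : (2:ℝ) ≤ N := by exact_mod_cast (by omega : 2 ≤ N)
    have : (w:ℝ) ≤ ((N - 1 : ℕ) : ℝ) := by
      rw [Nat.cast_sub (by omega)]; push_cast; linarith
    exact_mod_cast this
  have hM : 0 < N - 1 := by omega
  have hMr : (0:ℝ) < ((N - 1 : ℕ) : ℝ) := by exact_mod_cast hM
  have hch := choose_sub_le (N - 1) w (m N - 1) hM hwN
  have hfrac : (1 - w / (N - 1 : ℕ) : ℝ) ≤ 1 - δ / 8 := by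
    have : δ / 8 ≤ (w:ℝ) / (N - 1 : ℕ) := by
      rw [le_div_iff₀ hMr, Nat.cast_sub (by omega)]
      push_cast; nlinarith
    linarith
  have hfrac0 : (0:ℝ) ≤ 1 - w / (N - 1 : ℕ) := by
    have : (w:ℝ) / (N - 1 : ℕ) ≤ 1 := by
      rw [div_le_one hMr]; exact_mod_cast hwN
    linarith
  have hpw : (1 - w / (N - 1 : ℕ) : ℝ) ^ (m N - 1) ≤ δ / 8 :=
    (pow_le_pow_left₀ hfrac0 hfrac _).trans hN.le
  have hb := (Nat.cast_le (α := ℝ)).mpr (sum_straddling_le (N := N) (m := m N) a w)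
  refine hb.trans ?_
  push_cast
  set c := ((N - 1).choose (m N - 1) : ℝ)
  have hc : 0 ≤ c := by positivity
  have h5 : ((N - 1 - w).choose (m N - 1) : ℝ) ≤ c * (δ / 8) := hch.trans (by gcongr)
  calc c * (2 * w) + 2 * N * ((N - 1 - w).choose (m N - 1) : ℝ)
      ≤ c * (2 * (δ / 4 * N)) + 2 * N * (c * (δ / 8)) := by gcongr
    _ ≤ δ * N * c := by
      have : 0 ≤ δ * N * c := by positivity
      linarith

end Straddle

/-! ### Lower bound for the average log-likelihood -/

section LowerBound

variable {K N : ℕ} {I : Finset ℕ}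

/-- The integrand of the unnormalized Gibbs inequality for a positive weight `s`. -/
noncomputable def gibbs (s : Fin K → ℝ → ℝ) (g : Fin K) (y : ℝ) : ℝ :=
  Real.log (s g y) - ∑ g', s g' y + 1

/-- `T` separates any two points at which `F` differs by more than `η`. -/
def Separates (T : Finset ℝ) (η : ℝ) (F : ℝ → ℝ) : Prop :=
  ∀ a b, a < b → (∀ t ∈ T, ¬ (a ≤ t ∧ t < b)) → |F a - F b| ≤ η

/-- Freeze the weight in each cell at one observed value and apply Gibbs' inequality. Freezing costs
at most `η` per observation in a cell without a threshold and at most `2 L` elsewhere; the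
observations in a cell are as many as its width. -/
lemma gibbs_sum_le_condLogLik (x : Fin N → Fin K) {y : Fin N → ℝ} (hy : Function.Injective y)
    (hI : I ⊆ Finset.Icc 1 (N - 1)) {s : Fin K → ℝ → ℝ} (hs : ∀ g y, 0 < s g y)
    {T : Finset ℝ} {η L : ℝ} (hη : 0 ≤ η) (hT : ∀ g, Separates T η (gibbs s g))
    (hL : ∀ g y, |gibbs s g y| ≤ L) :
    ∑ i, gibbs s (x i) (y i) - η * N - 2 * L * ∑ t ∈ T,
        ((∑ C ∈ straddling N I (Finset.univ.filter fun j => y j ≤ t).card, (C.2 - C.1) : ℕ) : ℝ)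
      ≤ condLogLik (cellLabel I y) x := by
  classical
  set c := cellLabel I y with hc
  have hmem : ∀ i, c i ∈ cells N I := cellLabel_mem I y
  let rank' : ℝ → ℕ := fun t => (Finset.univ.filter fun j => y j ≤ t).card
  -- The default 0 is only used for labels that no observation carries.
  let rep : ℕ × ℕ → ℝ := fun a => if h : ∃ j, c j = a then y h.choose else 0
  have hrep : ∀ i, ∃ j, c j = c i ∧ rep (c i) = y j := by
    intro i
    have h : ∃ j, c j = c i := ⟨i, rfl⟩
    exact ⟨h.choose, h.choose_spec, by simp only [rep]; rw [dif_pos h]⟩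
  -- A threshold between two observations of one cell makes the number of observations up to it an
  -- interior cut of that cell. This matches the half-open intervals in `Separates`.
  have hstr : ∀ i j, c j = c i → y i < y j → (∃ t ∈ T, y i ≤ t ∧ t < y j) →
      ∃ t ∈ T, c i ∈ straddling N I (rank' t) := by
    rintro i j hij hlt ⟨t, ht, h1, h2⟩
    refine ⟨t, ht, Finset.mem_filter.mpr ⟨hmem i, ?_, ?_⟩⟩
    · have h3 := ((cellLabel_eq_iff hI y i (hmem i)).mp rfl).1
      have : rank y i ≤ rank' t := Finset.card_le_card fun k hk => by
        simp only [Finset.mem_filter, Finset.mem_univ, true_and] at hk ⊢; linarith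
      omega
    · have h3 := ((cellLabel_eq_iff hI y j (hmem i)).mp hij).2
      have : rank' t < rank y j := by
        refine Finset.card_lt_card ⟨fun k hk => ?_, fun hk => ?_⟩
        · simp only [Finset.mem_filter, Finset.mem_univ, true_and] at hk ⊢; linarith
        · have := hk (show j ∈ _ by simp)
          simp only [Finset.mem_filter, Finset.mem_univ, true_and] at this
          linarith
      omega
  have hLpos : ∀ i : Fin N, 0 ≤ L := fun i => (abs_nonneg _).trans (hL (x i) 0)
  have hpt : ∀ i, gibbs s (x i) (y i) - η
      - 2 * L * ∑ t ∈ T, ∑ C ∈ straddling N I (rank' t), (if c i = C then (1:ℝ) else 0)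
      ≤ gibbs s (x i) (rep (c i)) := by
    intro i
    have hL0 := hLpos i
    obtain ⟨j, hj, hr⟩ := hrep i
    rw [hr]
    have hnn : ∀ t ∈ T, 0 ≤ ∑ C ∈ straddling N I (rank' t), (if c i = C then (1:ℝ) else 0) :=
      fun t _ => Finset.sum_nonneg fun C _ => by split_ifs <;> norm_num
    by_cases hst : ∃ t ∈ T, c i ∈ straddling N I (rank' t)
    · obtain ⟨t, ht, hin⟩ := hst
      have h1 : 1 ≤ ∑ t ∈ T, ∑ C ∈ straddling N I (rank' t), (if c i = C then (1:ℝ) else 0) := by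
        refine le_trans (le_of_eq ?_) (Finset.single_le_sum hnn ht)
        rw [Finset.sum_ite_eq, if_pos hin]
      have h2 := abs_le.mp (hL (x i) (y i))
      have h3 := abs_le.mp (hL (x i) (y j))
      nlinarith
    · have h1 : |gibbs s (x i) (y i) - gibbs s (x i) (y j)| ≤ η := by
        rcases lt_trichotomy (y i) (y j) with h | h | h
        · refine hT (x i) _ _ h fun t ht h' => hst ?_
          exact hstr i j hj h ⟨t, ht, h'⟩
        · rw [h]; simpa using hη
        · rw [abs_sub_comm]
          refine hT (x i) _ _ h fun t ht h' => hst ?_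
          obtain ⟨t', ht', h''⟩ := hstr j i hj.symm h ⟨t, ht, h'⟩
          exact ⟨t', ht', hj ▸ h''⟩
      have h2 := Finset.sum_nonneg hnn
      have h3 := (abs_le.mp h1).2
      nlinarith
  have hsum : ∑ i, ∑ t ∈ T, ∑ C ∈ straddling N I (rank' t), (if c i = C then (1:ℝ) else 0)
      = ∑ t ∈ T, ((∑ C ∈ straddling N I (rank' t), (C.2 - C.1) : ℕ) : ℝ) := by
    rw [Finset.sum_comm]
    refine Finset.sum_congr rfl fun t _ => ?_
    rw [Finset.sum_comm, Nat.cast_sum]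
    refine Finset.sum_congr rfl fun C hC => ?_
    rw [← cellCount_cellLabel hI hy (Finset.mem_filter.mp hC).1, cellCount]
    simp [hc]
  calc _ = ∑ i, (gibbs s (x i) (y i) - η - 2 * L * ∑ t ∈ T,
        ∑ C ∈ straddling N I (rank' t), (if c i = C then (1:ℝ) else 0)) := by
        rw [Finset.sum_sub_distrib, Finset.sum_sub_distrib, ← Finset.mul_sum, hsum]
        simp [rank', mul_comm]
    _ ≤ ∑ i, gibbs s (x i) (rep (c i)) := Finset.sum_le_sum fun i _ => hpt i
    _ ≤ _ := sum_log_sub_le_condLogLik c x (fun a g => s g (rep a)) fun a g => hs g _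

/-- For large `N` the average log-likelihood is at least the Gibbs sum of a weight that is almost
constant between the points of a finite set. -/
lemma eventually_gibbs_le_avgLogLik (m : ℕ → ℕ) (hm : Tendsto m atTop atTop)
    (hmN : ∀ᶠ N in atTop, m N ≤ N) {s : Fin K → ℝ → ℝ} (hs : ∀ g y, 0 < s g y)
    {T : Finset ℝ} {η L : ℝ} (hη : 0 < η) (hT : ∀ g, Separates T η (gibbs s g))
    (hL : ∀ g y, |gibbs s g y| ≤ L) :
    ∀ᶠ N in atTop, ∀ (x : Fin N → Fin K) (y : Fin N → ℝ), Function.Injective y →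
      (∑ i, gibbs s (x i) (y i)) / N - 2 * η ≤ avgLogLik (m N) x y / N := by
  -- The straddling widths are allowed `η N` in total, shared among the thresholds and scaled by `2
  -- L`; the added ones keep the denominator positive.
  have hA : 0 < 2 * (|L| + 1) * (T.card + 1) := by positivity
  filter_upwards [hmN, eventually_ge_atTop 1,
    eventually_sum_straddling_le m hm (div_pos hη hA)] with N hN hN1 hst x y hy
  have hN0 : (0:ℝ) < N := by exact_mod_cast hN1
  have hch : (0:ℝ) < ((N - 1).choose (m N - 1) : ℝ) := by
    exact_mod_cast Nat.choose_pos (by omega)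
  have hLpos : 0 ≤ L := (abs_nonneg _).trans (hL (x ⟨0, hN1⟩) 0)
  set ch := ((N - 1).choose (m N - 1) : ℝ) with hchdef
  rw [div_sub' hN0.ne', div_le_div_iff_of_pos_right hN0, avgLogLik, le_div_iff₀ hch]
  have h1 := Finset.sum_le_sum fun I (hI : I ∈ partitions N (m N)) =>
    gibbs_sum_le_condLogLik x hy (subset_of_mem_partitions hI) hs hη.le hT hL
  refine le_trans ?_ h1
  rw [Finset.sum_sub_distrib, Finset.sum_const, card_partitions, ← Finset.mul_sum,
    Finset.sum_comm, nsmul_eq_mul, ← hchdef]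
  have h2 : ∑ t ∈ T, ∑ I ∈ partitions N (m N),
      ((∑ C ∈ straddling N I (Finset.univ.filter fun j => y j ≤ t).card, (C.2 - C.1) : ℕ) : ℝ)
      ≤ ∑ t ∈ T, (η / (2 * (|L| + 1) * (T.card + 1))) * N * ch := by
    refine Finset.sum_le_sum fun t _ => ?_
    rw [← Nat.cast_sum]
    exact hst _
  have h3 : 2 * L * ∑ t ∈ T, (η / (2 * (|L| + 1) * (T.card + 1))) * N * ch ≤ η * N * ch := by
    rw [Finset.sum_const, nsmul_eq_mul]
    have e : 2 * L * (T.card * (η / (2 * (|L| + 1) * (T.card + 1)) * N * ch))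
        = (η * N * ch) * ((L / (|L| + 1)) * (T.card / (T.card + 1))) := by
      field_simp
    rw [e]
    have u1 : L / (|L| + 1) ≤ 1 := by
      rw [div_le_one (by positivity)]; linarith [le_abs_self L]
    have u2 : (T.card : ℝ) / (T.card + 1) ≤ 1 := by
      rw [div_le_one (by positivity)]; linarith
    have u3 : (L / (|L| + 1)) * (T.card / (T.card + 1) : ℝ) ≤ 1 :=
      mul_le_one₀ u1 (by positivity) u2
    exact mul_le_of_le_one_right (by positivity) u3
  have h4 := mul_le_mul_of_nonneg_left h2 (show 0 ≤ 2 * L by positivity)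
  nlinarith

end LowerBound

/-! ### Finitely many thresholds for continuous functions of compact support -/

section Separation

lemma exists_separates {ι : Type*} [Fintype ι] (c : ι → ℝ → ℝ) (hc : ∀ i, Continuous (c i))
    (hcs : ∀ i, HasCompactSupport (c i)) {κ : ℝ} (hκ : 0 < κ) :
    ∃ T : Finset ℝ, ∀ i, Separates T κ (c i) := by
  classical
  have huc : ∀ i, ∃ d > 0, ∀ a b, dist a b < d → |c i a - c i b| < κ := fun i =>
    Metric.uniformContinuous_iff.mp ((hcs i).uniformContinuous_of_continuous (hc i)) κ hκ
  have hbd : ∀ i, ∃ R : ℝ, ∀ a, R < |a| → c i a = 0 := fun i => by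
    obtain ⟨R, hR⟩ := (hcs i).isCompact.isBounded.subset_closedBall 0
    refine ⟨R, fun a ha => ?_⟩
    by_contra h
    have := hR (subset_tsupport _ (Function.mem_support.mpr h))
    rw [mem_closedBall_zero_iff, Real.norm_eq_abs] at this
    linarith
  choose d hd huc using huc
  choose R hR using hbd
  have key : ∀ i, ∃ T : Finset ℝ, Separates T κ (c i) := by
    intro i
    have hd2 : 0 < d i / 2 := half_pos (hd i)
    obtain ⟨M, hM⟩ := exists_nat_gt (R i / (d i / 2))
    rw [div_lt_iff₀ hd2] at hM
    -- A grid of half the modulus of continuity, reaching past the support on both sides. Points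
    -- with no grid point between them are either close together or both on the same side outside
    -- the support.
    refine ⟨(Finset.Icc (-(M:ℤ)) M).image fun k : ℤ => (k:ℝ) * (d i / 2), ?_⟩
    intro a b hab hT
    by_cases hclose : b - a < d i
    · refine (huc i a b ?_).le
      rw [dist_comm, Real.dist_eq, abs_of_pos (by linarith)]
      exact hclose
    -- The first point of the infinite grid at or above `a` lies before `b`, since `b - a ≥ d i`. It
    -- is not in the finite grid, so `|k| > M`.
    · set k : ℤ := ⌈a / (d i / 2)⌉ with hk
      have k1 : a ≤ k * (d i / 2) := by
        rw [← div_le_iff₀ hd2]; exact Int.le_ceil _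
      have k2 : k * (d i / 2) < a + d i / 2 := by
        have := Int.ceil_lt_add_one (a / (d i / 2))
        rw [← hk] at this
        calc (k:ℝ) * (d i / 2) < (a / (d i / 2) + 1) * (d i / 2) := by gcongr
          _ = a + d i / 2 := by rw [add_mul, one_mul, div_mul_cancel₀ _ hd2.ne']
      have hkM : ¬ (-(M:ℤ) ≤ k ∧ k ≤ M) := fun h => hT (k * (d i / 2))
        (Finset.mem_image.mpr ⟨k, Finset.mem_Icc.mpr h, rfl⟩) ⟨k1, by linarith⟩
      have hz : R i < |a| ∧ R i < |b| := by
        rcases lt_or_ge (M:ℤ) k with h | h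
        · have h' : (M:ℝ) + 1 ≤ k := by exact_mod_cast h
          have : R i < a := by nlinarith
          exact ⟨this.trans_le (le_abs_self a), (this.trans hab).trans_le (le_abs_self b)⟩
        · have h1 : k ≤ -(M:ℤ) - 1 := by
            by_contra h2; exact hkM ⟨by omega, h⟩
          have h' : (k:ℝ) ≤ -M - 1 := by exact_mod_cast h1
          have ha : a < -(M * (d i / 2)) := by nlinarith
          have hb : b ≤ -(M * (d i / 2)) := by
            by_contra hb
            refine hT (((-(M:ℤ) : ℤ) : ℝ) * (d i / 2))
              (Finset.mem_image.mpr ⟨-(M:ℤ), Finset.mem_Icc.mpr ⟨le_rfl, by omega⟩, rfl⟩) ?_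
            push_cast
            exact ⟨by linarith, by linarith [not_le.mp hb]⟩
          exact ⟨by linarith [neg_le_abs a], by linarith [neg_le_abs b]⟩
      rw [hR i a hz.1, hR i b hz.2]
      simpa using hκ.le
  choose T hT using key
  exact ⟨Finset.univ.biUnion T, fun i a b hab h =>
    hT i a b hab fun t ht => h t (Finset.mem_biUnion.mpr ⟨i, Finset.mem_univ i, ht⟩)⟩

lemma log_sub_log_le {δ a b : ℝ} (hδ : 0 < δ) (ha : δ ≤ a) (hb : δ ≤ b) :
    Real.log a - Real.log b ≤ |a - b| / δ := by
  have hb0 : 0 < b := hδ.trans_le hb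
  have ha0 : 0 < a := hδ.trans_le ha
  rw [← Real.log_div ha0.ne' hb0.ne']
  calc Real.log (a / b) ≤ a / b - 1 := Real.log_le_sub_one_of_pos (by positivity)
    _ = (a - b) / b := by field_simp
    _ ≤ |a - b| / b := by gcongr; exact le_abs_self _
    _ ≤ |a - b| / δ := by gcongr

lemma abs_log_sub_log_le {δ a b : ℝ} (hδ : 0 < δ) (ha : δ ≤ a) (hb : δ ≤ b) :
    |Real.log a - Real.log b| ≤ |a - b| / δ := by
  rw [abs_le']
  refine ⟨log_sub_log_le hδ ha hb, ?_⟩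
  rw [neg_sub, abs_sub_comm]
  exact log_sub_log_le hδ hb ha

end Separation

/-! ### Posterior probabilities and their approximation by step-like weights -/

section Density

variable {K : ℕ} {p : Fin K → ℝ} {ν : Fin K → Measure ℝ} {f : Fin K → ℝ → ℝ}

/-- The mixture of the distributions `ν g` with weights `p g`. -/
noncomputable def mixture (p : Fin K → ℝ) (ν : Fin K → Measure ℝ) : Measure ℝ :=
  ∑ g, ENNReal.ofReal (p g) • ν g

instance [∀ g, IsProbabilityMeasure (ν g)] : IsFiniteMeasure (mixture p ν) := by
  unfold mixture
  have : ∀ g, IsFiniteMeasure (ENNReal.ofReal (p g) • ν g) := fun g =>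
    Measure.smul_finite _ ENNReal.ofReal_ne_top
  infer_instance

lemma isProbabilityMeasure_mixture [∀ g, IsProbabilityMeasure (ν g)] (hp : ∀ g, 0 < p g)
    (hp1 : ∑ g, p g = 1) : IsProbabilityMeasure (mixture p ν) := by
  constructor
  simp only [mixture, Measure.coe_finsetSum, Finset.sum_apply, Measure.smul_apply, measure_univ,
    smul_eq_mul, mul_one]
  rw [← ENNReal.ofReal_sum_of_nonneg fun g _ => (hp g).le, hp1, ENNReal.ofReal_one]

/-- `f g` is the posterior probability of the category `g`, as a function of the value of `Y`. -/
structure IsPosterior (p : Fin K → ℝ) (ν : Fin K → Measure ℝ) (f : Fin K → ℝ → ℝ) : Prop where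
  measurable : ∀ g, Measurable (f g)
  nonneg : ∀ g y, 0 ≤ f g y
  le_one : ∀ g y, f g y ≤ 1
  withDensity_eq : ∀ g, ENNReal.ofReal (p g) • ν g
    = (mixture p ν).withDensity fun y => ENNReal.ofReal (f g y)

lemma smul_le_mixture (p : Fin K → ℝ) (ν : Fin K → Measure ℝ) (g : Fin K) :
    ENNReal.ofReal (p g) • ν g ≤ mixture p ν := by
  refine Measure.le_iff.mpr fun s _ => ?_
  unfold mixture
  rw [Measure.coe_finsetSum, Finset.sum_apply]
  exact Finset.single_le_sum (f := fun g => (ENNReal.ofReal (p g) • ν g) s)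
    (fun _ _ => zero_le) (Finset.mem_univ g)

/-- The Radon–Nikodym density of `p g • ν g` with respect to the mixture is almost everywhere at
most 1, because the mixture dominates; truncation at 1 makes the bound hold everywhere. -/
lemma exists_isPosterior (p : Fin K → ℝ) (ν : Fin K → Measure ℝ)
    [∀ g, IsProbabilityMeasure (ν g)] : ∃ f, IsPosterior p ν f := by
  have hfin : ∀ g, IsFiniteMeasure (ENNReal.ofReal (p g) • ν g) := fun g =>
    Measure.smul_finite _ ENNReal.ofReal_ne_top
  refine ⟨fun g y => min ((ENNReal.ofReal (p g) • ν g).rnDeriv (mixture p ν) y).toReal 1,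
    fun g => (Measure.measurable_rnDeriv _ _).ennreal_toReal.min measurable_const,
    fun g y => le_min ENNReal.toReal_nonneg zero_le_one, fun g y => min_le_right _ _, fun g => ?_⟩
  have hle := smul_le_mixture p ν g
  conv_lhs => rw [← Measure.withDensity_rnDeriv_eq _ _ (Measure.absolutelyContinuous_of_le hle)]
  refine withDensity_congr_ae ?_
  filter_upwards [Measure.rnDeriv_le_one_of_le hle] with y hy
  have hy' : (ENNReal.ofReal (p g) • ν g).rnDeriv (mixture p ν) y ≤ 1 := hy
  have h1 : ((ENNReal.ofReal (p g) • ν g).rnDeriv (mixture p ν) y).toReal ≤ 1 := by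
    simpa using ENNReal.toReal_mono ENNReal.one_ne_top hy'
  rw [min_eq_left h1, ENNReal.ofReal_toReal (hy'.trans_lt ENNReal.one_lt_top).ne]

lemma integral_mixture (hp : ∀ g, 0 < p g) {F : ℝ → ℝ} (hF : ∀ g, Integrable F (ν g)) :
    ∫ y, F y ∂(mixture p ν) = ∑ g, p g * ∫ y, F y ∂(ν g) := by
  unfold mixture
  rw [integral_finsetSum_measure fun g _ => (hF g).smul_measure ENNReal.ofReal_ne_top]
  refine Finset.sum_congr rfl fun g _ => ?_
  rw [integral_smul_measure, ENNReal.toReal_ofReal (hp g).le, smul_eq_mul]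

lemma integrable_of_mixture (hp : ∀ g, 0 < p g) {F : ℝ → ℝ} (hF : Integrable F (mixture p ν))
    (g : Fin K) : Integrable F (ν g) := by
  have h := hF.mono_measure (smul_le_mixture p ν g)
  exact (integrable_smul_measure (by simpa using hp g) ENNReal.ofReal_ne_top).mp h

lemma integrable_of_bdd {ρ : Measure ℝ} [IsFiniteMeasure ρ] {F : ℝ → ℝ} (hF : Measurable F)
    {C : ℝ} (hC : ∀ y, |F y| ≤ C) : Integrable F ρ :=
  Integrable.of_bound hF.aestronglyMeasurable C (ae_of_all _ hC)

namespace IsPosterior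

variable (hf : IsPosterior p ν f)
include hf

lemma mul_lintegral (g : Fin K) {F : ℝ → ENNReal} (hF : Measurable F) :
    ENNReal.ofReal (p g) * ∫⁻ y, F y ∂(ν g)
      = ∫⁻ y, ENNReal.ofReal (f g y) * F y ∂(mixture p ν) := by
  rw [← smul_eq_mul, ← lintegral_smul_measure, hf.withDensity_eq g,
    lintegral_withDensity_eq_lintegral_mul _ (hf.measurable g).ennreal_ofReal hF]
  rfl

lemma mul_integral (hp : ∀ g, 0 < p g) (g : Fin K) (F : ℝ → ℝ) :
    p g * ∫ y, F y ∂(ν g) = ∫ y, f g y * F y ∂(mixture p ν) := by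
  have h : ∫ y, F y ∂(ENNReal.ofReal (p g) • ν g) = p g * ∫ y, F y ∂(ν g) := by
    rw [integral_smul_measure, ENNReal.toReal_ofReal (hp g).le, smul_eq_mul]
  rw [← h, hf.withDensity_eq g, integral_withDensity_eq_integral_toReal_smul
    (hf.measurable g).ennreal_ofReal (ae_of_all _ fun _ => ENNReal.ofReal_lt_top)]
  refine integral_congr_ae (ae_of_all _ fun y => ?_)
  simp [ENNReal.toReal_ofReal (hf.nonneg g y)]

lemma measurable_log (g : Fin K) : Measurable fun y => Real.log (f g y) :=
  Real.measurable_log.comp (hf.measurable g)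

lemma ae_pos (hp : ∀ g, 0 < p g) (g : Fin K) : ∀ᵐ y ∂(ν g), 0 < f g y := by
  have h := hf.mul_lintegral g (F := Set.indicator (f g ⁻¹' {0}) 1)
    (measurable_one.indicator (hf.measurable g (measurableSet_singleton 0)))
  rw [lintegral_indicator_one (hf.measurable g (measurableSet_singleton 0))] at h
  have h0 : ∀ y, ENNReal.ofReal (f g y) * Set.indicator (f g ⁻¹' {0}) (1 : ℝ → ENNReal) y = 0 := by
    intro y
    by_cases hy : f g y = 0
    · simp [hy]
    · simp [hy]
  simp only [h0, lintegral_zero, mul_eq_zero, ENNReal.ofReal_eq_zero, not_le.mpr (hp g),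
    false_or] at h
  have : ∀ᵐ y ∂(ν g), ¬ (f g y = 0) := by
    rw [ae_iff]
    simp only [not_not]
    exact h
  filter_upwards [this] with y hy
  exact lt_of_le_of_ne (hf.nonneg g y) (Ne.symm hy)

variable [∀ g, IsProbabilityMeasure (ν g)]

/-- Against the mixture the second moment becomes the integral of `f log² f`, which is bounded on
`[0, 1]`. It makes the mutual information finite and gives Chebyshev's inequality a variance,
without assumptions on `ν`. -/
lemma memLp_log (hp : ∀ g, 0 < p g) (g : Fin K) :
    MemLp (fun y => Real.log (f g y)) 2 (ν g) := by
  rw [memLp_two_iff_integrable_sq (hf.measurable_log g).aestronglyMeasurable]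
  have hpg : ENNReal.ofReal (p g) ≠ 0 := by simpa using hp g
  rw [← integrable_smul_measure hpg ENNReal.ofReal_ne_top, hf.withDensity_eq g,
    integrable_withDensity_iff (hf.measurable g).ennreal_ofReal
      (ae_of_all _ fun _ => ENNReal.ofReal_lt_top)]
  refine integrable_of_bdd (C := 4)
    (((hf.measurable_log g).pow_const 2).mul (hf.measurable g).ennreal_ofReal.ennreal_toReal) ?_
  intro y
  rw [ENNReal.toReal_ofReal (hf.nonneg g y)]
  rcases (hf.nonneg g y).eq_or_lt with h0 | h0
  · simp [← h0]
  · have h := Real.abs_log_mul_self_rpow_lt (f g y) (1 / 2) h0 (hf.le_one g y) (by norm_num)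
    rw [← Real.sqrt_eq_rpow] at h
    have e : Real.log (f g y) ^ 2 * f g y = |Real.log (f g y) * Real.sqrt (f g y)| ^ 2 := by
      rw [sq_abs, mul_pow, Real.sq_sqrt h0.le]
    rw [e, abs_of_nonneg (by positivity)]
    have h2 := abs_nonneg (Real.log (f g y) * Real.sqrt (f g y))
    nlinarith

lemma integrable_log (hp : ∀ g, 0 < p g) (g : Fin K) :
    Integrable (fun y => Real.log (f g y)) (ν g) :=
  (hf.memLp_log hp g).integrable (by norm_num)

/-- Bounded weights that are almost constant between finitely many points attain, up to `ε`,
the expected log-posterior in the Gibbs inequality. -/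
lemma exists_gibbs_approx (hp : ∀ g, 0 < p g) (hp1 : ∑ g, p g = 1) {ε : ℝ} (hε : 0 < ε) :
    ∃ (s : Fin K → ℝ → ℝ) (T : Finset ℝ) (L : ℝ), (∀ g, Measurable (s g)) ∧ (∀ g y, 0 < s g y) ∧
      (∀ g, Separates T ε (gibbs s g)) ∧ (∀ g y, |gibbs s g y| ≤ L) ∧
      ∑ g, p g * ∫ y, Real.log (f g y) ∂(ν g) - ε ≤ ∑ g, p g * ∫ y, gibbs s g y ∂(ν g) := by
  -- `δ` keeps the weights away from 0 and `κ` is the accuracy of the approximation. The losses `K κ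
  -- / δ`, `K δ` and `K κ` are each at most `ε / 4`.
  set δ := ε / (4 * (K + 1)) with hδdef
  have hδ : 0 < δ := by positivity
  set κ := ε * δ / (4 * (K + 1) * (1 + δ)) with hκdef
  have hκ : 0 < κ := by positivity
  have hKδ : K * δ ≤ ε / 4 := by
    rw [hδdef, mul_div_assoc', div_le_iff₀ (by positivity)]; nlinarith
  have hK1 : (K + 1) * κ / δ ≤ ε / 4 := by
    have : (K + 1) * κ / δ = ε / 4 / (1 + δ) := by rw [hκdef]; field_simp
    rw [this]; exact div_le_self (by positivity) (by linarith)
  have hKκ : K * κ ≤ ε / 4 := by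
    have : (K + 1) * κ = ε / 4 * (δ / (1 + δ)) := by rw [hκdef]; field_simp
    have h2 : δ / (1 + δ) ≤ 1 := by rw [div_le_one (by positivity)]; linarith
    nlinarith
  have hκδ : κ / δ ≤ ε / 4 := by
    refine le_trans ?_ hK1
    gcongr
    have : (0:ℝ) ≤ K := by positivity
    nlinarith
  have hKκδ : K * (κ / δ) ≤ ε / 4 := by
    have : (K + 1) * κ / δ = K * (κ / δ) + κ / δ := by ring
    have : 0 ≤ κ / δ := by positivity
    linarith
  have hfb : ∀ g y, |f g y| ≤ 1 := fun g y => by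
    rw [abs_of_nonneg (hf.nonneg g y)]; exact hf.le_one g y
  have hfi : ∀ g, Integrable (f g) (mixture p ν) := fun g =>
    integrable_of_bdd (hf.measurable g) (hfb g)
  have hc := fun g => (hfi g).exists_hasCompactSupport_integral_sub_le hκ
  choose c hcs hcκ hcc hci using hc
  obtain ⟨T, hT⟩ := exists_separates c hcc hcs hκ
  -- Clipping to `[0, 1]` is 1-Lipschitz and fixes `f`, so it spoils neither the distance to `f` nor
  -- the separation by `T`.
  let s : Fin K → ℝ → ℝ := fun g y => max 0 (min 1 (c g y)) + δ
  have hclip : ∀ a b : ℝ, |max 0 (min 1 a) - max 0 (min 1 b)| ≤ |a - b| := fun a b =>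
    (abs_max_sub_max_le_max 0 _ 0 _).trans (by
      rw [sub_self, abs_zero]
      refine max_le (abs_nonneg _) ((abs_min_sub_min_le_max 1 a 1 b).trans ?_)
      rw [sub_self, abs_zero]
      exact max_le (abs_nonneg _) le_rfl)
  have hsδ : ∀ g y, δ ≤ s g y := fun g y => by
    have := le_max_left 0 (min 1 (c g y)); simp only [s]; linarith
  have hs1 : ∀ g y, s g y ≤ 1 + δ := fun g y => by
    have : max 0 (min 1 (c g y)) ≤ 1 := max_le zero_le_one (min_le_left _ _)
    simp only [s]; linarith
  have hsm : ∀ g, Measurable (s g) := fun g =>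
    (measurable_const.max (measurable_const.min (hcc g).measurable)).add_const δ
  have hs0 : ∀ g y, 0 < s g y := fun g y => hδ.trans_le (hsδ g y)
  have hsf : ∀ g y, |f g y + δ - s g y| ≤ |f g y - c g y| := fun g y => by
    have := hclip (f g y) (c g y)
    rw [min_eq_right (hf.le_one g y), max_eq_right (hf.nonneg g y)] at this
    simpa [s] using this
  have hss : ∀ g a b, |s g a - s g b| ≤ |c g a - c g b| := fun g a b => by
    simpa [s] using hclip (c g a) (c g b)
  have hlogs : ∀ g y, |Real.log (s g y)| ≤ |Real.log δ| + Real.log (1 + δ) := fun g y => by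
    have h1 := Real.log_le_log hδ (hsδ g y)
    have h2 := Real.log_le_log (hs0 g y) (hs1 g y)
    have h3 : 0 ≤ Real.log (1 + δ) := Real.log_nonneg (by linarith)
    rw [abs_le]
    constructor <;> linarith [neg_abs_le (Real.log δ), abs_nonneg (Real.log δ)]
  have hsum : ∀ y, |∑ g, s g y| ≤ K * (1 + δ) := fun y => by
    rw [abs_of_nonneg (Finset.sum_nonneg fun g _ => (hs0 g y).le)]
    refine (Finset.sum_le_sum fun g _ => hs1 g y).trans (le_of_eq ?_)
    rw [Finset.sum_const, Finset.card_univ, Fintype.card_fin, nsmul_eq_mul]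
  have hgb : ∀ g y, |gibbs s g y| ≤ |Real.log δ| + Real.log (1 + δ) + K * (1 + δ) + 1 := by
    intro g y
    unfold gibbs
    have h1 := abs_le.mp (hlogs g y)
    have h2 := abs_le.mp (hsum y)
    rw [abs_le]
    constructor <;> linarith
  have hgm : ∀ g, Measurable (gibbs s g) := fun g =>
    ((Real.measurable_log.comp (hsm g)).sub (Finset.measurable_fun_sum _ fun g _ => hsm g)).add_const 1
  refine ⟨s, T, _, hsm, hs0, ?_, hgb, ?_⟩
  · intro g a b hab hsep
    have h1 : |Real.log (s g a) - Real.log (s g b)| ≤ κ / δ :=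
      (abs_log_sub_log_le hδ (hsδ g a) (hsδ g b)).trans (by
        gcongr; exact (hss g a b).trans (hT g a b hab hsep))
    have h2 : |∑ g, s g a - ∑ g, s g b| ≤ K * κ := by
      rw [← Finset.sum_sub_distrib]
      refine (Finset.abs_sum_le_sum_abs _ _).trans ?_
      refine (Finset.sum_le_sum fun g _ => (hss g a b).trans (hT g a b hab hsep)).trans ?_
      simp
    unfold gibbs
    have h3 := abs_le.mp h1
    have h4 := abs_le.mp h2
    rw [abs_le]
    constructor <;> linarith
  · have hci' : ∀ g, Integrable (fun y => |f g y - c g y|) (mixture p ν) := fun g =>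
      ((hfi g).sub (hci g)).abs
    have hcν : ∀ g, Integrable (fun y => |f g y - c g y|) (ν g) := fun g =>
      integrable_of_mixture hp (hci' g) g
    have hsi : ∀ g (ρ : Measure ℝ) [IsFiniteMeasure ρ], Integrable (s g) ρ := fun g ρ _ =>
      integrable_of_bdd (C := 1 + δ) (hsm g) fun y => by
        rw [abs_of_pos (hs0 g y)]; exact hs1 g y
    have hSi : ∀ (ρ : Measure ℝ) [IsFiniteMeasure ρ], Integrable (fun y => ∑ g, s g y - 1) ρ :=
      fun ρ _ => (integrable_finsetSum _ fun g _ => hsi g ρ).sub (integrable_const 1)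
    have hgi : ∀ g, Integrable (gibbs s g) (ν g) := fun g => integrable_of_bdd (hgm g) (hgb g)
    -- Pointwise `log f ≤ log (f + δ) ≤ log s + |f - c| / δ`, where `f > 0` is needed because
    -- `Real.log 0 = 0`.
    have h1 : ∀ g, ∫ y, Real.log (f g y) ∂(ν g) - (∫ y, |f g y - c g y| ∂(ν g)) / δ
        - ∫ y, (∑ g, s g y - 1) ∂(ν g) ≤ ∫ y, gibbs s g y ∂(ν g) := by
      intro g
      have hA : Integrable (fun y => Real.log (f g y) - |f g y - c g y| / δ) (ν g) :=
        (hf.integrable_log hp g).sub ((hcν g).div_const δ)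
      rw [← integral_div, ← integral_sub (hf.integrable_log hp g) ((hcν g).div_const δ),
        ← integral_sub hA (hSi (ν g))]
      refine integral_mono_ae (hA.sub (hSi (ν g))) (hgi g) ?_
      filter_upwards [hf.ae_pos hp g] with y hy
      have e1 : Real.log (f g y) ≤ Real.log (f g y + δ) := Real.log_le_log hy (by linarith)
      have e2 := log_sub_log_le (a := f g y + δ) (b := s g y) hδ (by linarith) (hsδ g y)
      have e3 : |f g y + δ - s g y| / δ ≤ |f g y - c g y| / δ :=
        div_le_div_of_nonneg_right (hsf g y) hδ.le
      simp only [gibbs]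
      linarith
    have h2 : ∀ g, p g * ∫ y, |f g y - c g y| ∂(ν g) ≤ κ := by
      intro g
      rw [hf.mul_integral hp]
      refine le_trans (integral_mono_of_nonneg (ae_of_all _ fun y => ?_) (hci' g)
        (ae_of_all _ fun y => ?_)) (hcκ g)
      · exact mul_nonneg (hf.nonneg g y) (abs_nonneg _)
      · exact mul_le_of_le_one_left (abs_nonneg _) (hf.le_one g y)
    have h3 : ∀ g, ∫ y, s g y ∂(mixture p ν) ≤ p g + δ + κ := by
      intro g
      have := isProbabilityMeasure_mixture (ν := ν) hp hp1
      have e : ∫ y, f g y ∂(mixture p ν) = p g := by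
        have := hf.mul_integral hp g fun _ => 1
        simpa using this.symm
      have hB : Integrable (fun y => f g y + δ) (mixture p ν) := (hfi g).add (integrable_const δ)
      have hle : ∫ y, s g y ∂(mixture p ν)
          ≤ ∫ y, ((f g y + δ) + |f g y - c g y|) ∂(mixture p ν) := by
        refine integral_mono (hsi g _) (hB.add (hci' g)) fun y => ?_
        have := (abs_le.mp (hsf g y)).1
        simp only; linarith
      rw [integral_add hB (hci' g),
        integral_add (hfi g) (integrable_const δ), e] at hle
      have := hcκ g
      simp only [Real.norm_eq_abs] at this
      simp at hle
      linarith
    -- The excess mass of the unnormalized weights: each `s g` has mixture integral at most `p g + δ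
    -- + κ`, and the `p g` add up to 1.
    have h4 : ∑ g, p g * ∫ y, (∑ g, s g y - 1) ∂(ν g) ≤ K * δ + K * κ := by
      have := isProbabilityMeasure_mixture (ν := ν) hp hp1
      rw [← integral_mixture hp fun g => hSi (ν g), integral_sub
        (integrable_finsetSum _ fun g _ => hsi g _) (integrable_const 1),
        integral_finsetSum _ fun g _ => hsi g _]
      have := Finset.sum_le_sum fun g (_ : g ∈ Finset.univ) => h3 g
      simp only [Finset.sum_add_distrib, hp1] at this
      simp at this ⊢
      linarith
    have h5 : ∑ g, (p g * ∫ y, Real.log (f g y) ∂(ν g) - κ / δ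
        - p g * ∫ y, (∑ g, s g y - 1) ∂(ν g)) ≤ ∑ g, p g * ∫ y, gibbs s g y ∂(ν g) := by
      refine Finset.sum_le_sum fun g _ => ?_
      refine le_trans ?_ (mul_le_mul_of_nonneg_left (h1 g) (hp g).le)
      have : (p g * ∫ y, |f g y - c g y| ∂(ν g)) / δ ≤ κ / δ := by gcongr; exact h2 g
      rw [mul_sub, mul_sub, mul_div_assoc']
      linarith
    rw [Finset.sum_sub_distrib, Finset.sum_sub_distrib] at h5
    simp only [Finset.sum_const, Finset.card_univ, Fintype.card_fin, nsmul_eq_mul] at h5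
    linarith

end IsPosterior

end Density

/-! ### Measurability through the ranks -/

section Measurability

variable {K N : ℕ}

lemma measurable_rank : Measurable fun (y : Fin N → ℝ) => rank y := by
  refine measurable_pi_iff.mpr fun i => ?_
  simp only [rank, Finset.card_filter]
  exact Finset.measurable_fun_sum _ fun j _ => Measurable.ite
    (measurableSet_le (measurable_pi_apply j) (measurable_pi_apply i))
    measurable_const measurable_const

/-- Everything combinatorial factors through the categories and ranks, a countable discrete space.
-/
lemma measurable_apply_rank (H : (Fin N → Fin K) × (Fin N → ℕ) → ℝ) :
    Measurable fun z : (Fin N → Fin K) × (Fin N → ℝ) => H (z.1, rank z.2) :=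
  (measurable_of_countable H).comp (measurable_fst.prodMk (measurable_rank.comp measurable_snd))

lemma measurable_apply_rank_right (H : (Fin N → ℕ) → ℝ) :
    Measurable fun y : Fin N → ℝ => H (rank y) :=
  (measurable_of_countable H).comp measurable_rank

lemma measurable_condLogLik (I : Finset ℕ) :
    Measurable fun z : (Fin N → Fin K) × (Fin N → ℝ) => condLogLik (cellLabel I z.2) z.1 :=
  measurable_apply_rank fun z => condLogLik (fun i => cellOf N I (z.2 i)) z.1

lemma measurable_condLogLik_right (I : Finset ℕ) (x : Fin N → Fin K) :
    Measurable fun y : Fin N → ℝ => condLogLik (cellLabel I y) x :=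
  measurable_apply_rank_right fun r => condLogLik (fun i => cellOf N I (r i)) x

lemma measurable_sum_apply {ψ : Fin K → ℝ → ℝ} (hψ : ∀ g, Measurable (ψ g)) :
    Measurable fun z : (Fin N → Fin K) × (Fin N → ℝ) => ∑ i, ψ (z.1 i) (z.2 i) := by
  have h : Measurable fun z : Fin K × ℝ => ψ z.1 z.2 := measurable_from_prod_countable_right hψ
  refine Finset.measurable_fun_sum _ fun i _ => ?_
  have h' : Measurable fun z : (Fin N → Fin K) × (Fin N → ℝ) => (z.1 i, z.2 i) :=
    ((measurable_pi_apply i).comp measurable_fst).prodMk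
      ((measurable_pi_apply i).comp measurable_snd)
  exact h.comp h'

end Measurability

/-! ### Consistency from a law of large numbers and an exponential moment bound -/

section Consistency

variable {K : ℕ} {p : Fin K → ℝ} {ν : Fin K → Measure ℝ} {f : Fin K → ℝ → ℝ}

/-- The log-likelihood of the categories `x` given the values `y`. -/
noncomputable def logPosterior {N : ℕ} (f : Fin K → ℝ → ℝ) (x : Fin N → Fin K)
    (y : Fin N → ℝ) : ℝ :=
  ∑ i, Real.log (f (x i) (y i))

/-- Jensen's inequality for the uniform distribution on partitions. It lets a moment bound for each
single partition control the average, with no union bound. -/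
lemma exp_avgLogLik_sub_le {N m : ℕ} (hm : m ≤ N) (x : Fin N → Fin K) (y : Fin N → ℝ) (V : ℝ) :
    Real.exp (avgLogLik m x y - V)
      ≤ ∑ I ∈ partitions N m, ((N - 1).choose (m - 1) : ℝ)⁻¹
        * Real.exp (condLogLik (cellLabel I y) x - V) := by
  have hch : (0:ℝ) < ((N - 1).choose (m - 1) : ℝ) := by
    exact_mod_cast Nat.choose_pos (by omega)
  have h1 : ∑ _I ∈ partitions N m, ((N - 1).choose (m - 1) : ℝ)⁻¹ = 1 := by
    rw [Finset.sum_const, card_partitions, nsmul_eq_mul, mul_inv_cancel₀ hch.ne']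
  have h := convexOn_exp.map_sum_le (t := partitions N m)
    (w := fun _ => ((N - 1).choose (m - 1) : ℝ)⁻¹)
    (p := fun I => condLogLik (cellLabel I y) x - V)
    (fun _ _ => by positivity) h1 (fun _ _ => Set.mem_univ _)
  simp only [smul_eq_mul] at h
  refine le_trans (le_of_eq ?_) h
  congr 1
  simp only [mul_sub]
  rw [Finset.sum_sub_distrib, ← Finset.sum_mul, h1, ← Finset.mul_sum, avgLogLik, one_mul]
  ring

variable [∀ g, IsProbabilityMeasure (ν g)]

/-- The sum statistic is consistent under a law of large numbers, once the maximal likelihood of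
the categories given their cells exceeds the true likelihood by a subexponential factor in mean. -/
theorem tendstoInMeasure_estimator {Ω : Type*} [MeasurableSpace Ω] {μ : Measure Ω}
    [IsProbabilityMeasure μ] (m : ℕ → ℕ) (hm : Tendsto m atTop atTop)
    (hmN : ∀ᶠ N in atTop, m N ≤ N) (hf : IsPosterior p ν f) (hp : ∀ g, 0 < p g)
    (hp1 : ∑ g, p g = 1)
    (x : (N : ℕ) → Ω → Fin N → Fin K) (Y : (N : ℕ) → Ω → Fin N → ℝ)
    (hx : ∀ N, Measurable (x N)) (hY : ∀ N, Measurable (Y N))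
    (hinj : ∀ N, ∀ᵐ ω ∂μ, Function.Injective (Y N ω))
    (hcount : ∀ g, ∀ᵐ ω ∂μ, Tendsto (fun N : ℕ => (groupCount (x N ω) g : ℝ) / (N : ℝ))
      atTop (𝓝 (p g)))
    (hlln : ∀ ψ : Fin K → ℝ → ℝ, (∀ g, Measurable (ψ g)) → (∀ g, MemLp (ψ g) 2 (ν g)) →
      TendstoInMeasure μ (fun (N : ℕ) ω => (∑ i, ψ (x N ω i) (Y N ω i)) / (N : ℝ)) atTop
        (fun _ => ∑ g, p g * ∫ y, ψ g y ∂(ν g)))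
    (hexp : ∀ δ : ℝ, 0 < δ → ∀ᶠ N in atTop, ∀ I ∈ partitions N (m N),
      ∫⁻ ω, ENNReal.ofReal (Real.exp (condLogLik (cellLabel I (Y N ω)) (x N ω)
        - logPosterior f (x N ω) (Y N ω))) ∂μ ≤ ENNReal.ofReal (Real.exp (δ * N))) :
    TendstoInMeasure μ (fun (N : ℕ) ω => estimator (x N ω) (Y N ω) (m N)) atTop
      (fun _ => ∑ g, p g * ∫ y, Real.log (f g y) ∂(ν g) - ∑ g, p g * Real.log (p g)) := by
  rw [tendstoInMeasure_iff_dist]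
  intro ε₀ hε₀
  -- Outside the four bad events the total error is below `5 ε`: the lower bound loses `ε` to
  -- approximation, `ε` to the law of large numbers, `2 ε` to the cells and `ε` to the category
  -- term. The upper bound loses `3 ε`.
  set ε := ε₀ / 8 with hεdef
  have hε : 0 < ε := by positivity
  obtain ⟨s, T, L, hsm, hs0, hsT, hsL, hsI⟩ := hf.exists_gibbs_approx hp hp1 hε
  have hgm : ∀ g, Measurable (gibbs s g) := fun g =>
    ((Real.measurable_log.comp (hsm g)).sub
      (Finset.measurable_fun_sum _ fun g _ => hsm g)).add_const 1
  have hgL : ∀ g, MemLp (gibbs s g) 2 (ν g) := fun g =>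
    MemLp.of_bound (hgm g).aestronglyMeasurable L (ae_of_all _ (hsL g))
  have t1 := tendstoInMeasure_iff_dist.mp
    (hlln (fun g y => Real.log (f g y)) hf.measurable_log fun g => hf.memLp_log hp g) ε hε
  have t2 := tendstoInMeasure_iff_dist.mp (hlln (gibbs s) hgm hgL) ε hε
  have t3 : Tendsto (fun N : ℕ => μ {ω | ε ≤ dist
      (∑ g, (groupCount (x N ω) g / N : ℝ) * Real.log (groupCount (x N ω) g / N))
      (∑ g, p g * Real.log (p g))}) atTop (𝓝 0) := by
    refine tendstoInMeasure_iff_dist.mp (tendstoInMeasure_of_tendsto_ae (fun N => ?_) ?_) ε hε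
    · have h : Measurable fun z : Fin N → Fin K =>
          ∑ g, (groupCount z g / N : ℝ) * Real.log (groupCount z g / N) := Measurable.of_discrete
      exact (h.comp (hx N)).aestronglyMeasurable
    · filter_upwards [ae_all_iff.mpr hcount] with ω hω
      exact tendsto_finsetSum _ fun g _ =>
        (Real.continuous_mul_log.tendsto (p g)).comp (hω g)
  -- Markov's inequality: a mean of at most `exp (ε N / 2)` against the level `exp (ε N)`.
  have t4 : Tendsto (fun N : ℕ => μ {ω | ε * N ≤ avgLogLik (m N) (x N ω) (Y N ω)
      - logPosterior f (x N ω) (Y N ω)}) atTop (𝓝 0) := by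
    have hlim : Tendsto (fun N : ℕ => ENNReal.ofReal (Real.exp (-(ε / 2) * N))) atTop (𝓝 0) := by
      rw [← ENNReal.ofReal_zero]
      refine ENNReal.tendsto_ofReal (Real.tendsto_exp_atBot.comp ?_)
      exact tendsto_natCast_atTop_atTop.const_mul_atTop_of_neg (by linarith)
    refine tendsto_of_tendsto_of_tendsto_of_le_of_le' tendsto_const_nhds hlim
      (Eventually.of_forall fun _ => zero_le) ?_
    filter_upwards [hexp (ε / 2) (half_pos hε), hmN] with N hN hmN'
    have hch : (0:ℝ) < ((N - 1).choose (m N - 1) : ℝ) := by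
      exact_mod_cast Nat.choose_pos (by omega)
    have hmeasI : ∀ I, Measurable fun ω => ENNReal.ofReal (Real.exp
        (condLogLik (cellLabel I (Y N ω)) (x N ω) - logPosterior f (x N ω) (Y N ω))) := fun I =>
      (Real.measurable_exp.comp ((((measurable_condLogLik I).sub
        (measurable_sum_apply hf.measurable_log)).comp
          ((hx N).prodMk (hY N))))).ennreal_ofReal
    set Φ : Ω → ENNReal := fun ω => ∑ I ∈ partitions N (m N),
      ENNReal.ofReal ((N - 1).choose (m N - 1) : ℝ)⁻¹ * ENNReal.ofReal (Real.exp
        (condLogLik (cellLabel I (Y N ω)) (x N ω) - logPosterior f (x N ω) (Y N ω))) with hΦ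
    have hΦm : Measurable Φ := Finset.measurable_fun_sum _ fun I _ => (hmeasI I).const_mul _
    have hint : ∫⁻ ω, Φ ω ∂μ ≤ ENNReal.ofReal (Real.exp (ε / 2 * N)) := by
      rw [hΦ, lintegral_finsetSum _ fun I _ => (hmeasI I).const_mul _]
      calc _ ≤ ∑ I ∈ partitions N (m N), ENNReal.ofReal ((N - 1).choose (m N - 1) : ℝ)⁻¹
            * ENNReal.ofReal (Real.exp (ε / 2 * N)) := by
            refine Finset.sum_le_sum fun I hI => ?_
            rw [lintegral_const_mul _ (hmeasI I)]
            gcongr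
            exact hN I hI
        _ = ENNReal.ofReal (Real.exp (ε / 2 * N)) := by
            rw [Finset.sum_const, card_partitions, nsmul_eq_mul, ← mul_assoc,
              ← ENNReal.ofReal_natCast, ← ENNReal.ofReal_mul (by positivity),
              mul_inv_cancel₀ hch.ne', ENNReal.ofReal_one, one_mul]
    have hne : ENNReal.ofReal (Real.exp (ε * N)) ≠ 0 := by
      simpa using Real.exp_pos _
    calc _ ≤ μ {ω | ENNReal.ofReal (Real.exp (ε * N)) ≤ Φ ω} := by
          refine measure_mono fun ω hω => ?_
          refine (ENNReal.ofReal_le_ofReal ((Real.exp_le_exp.mpr hω).trans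
            (exp_avgLogLik_sub_le hmN' _ _ _))).trans (le_of_eq ?_)
          rw [ENNReal.ofReal_sum_of_nonneg fun I _ => by positivity]
          exact Finset.sum_congr rfl fun I _ => ENNReal.ofReal_mul (by positivity)
      _ ≤ (∫⁻ ω, Φ ω ∂μ) / ENNReal.ofReal (Real.exp (ε * N)) :=
          meas_ge_le_lintegral_div hΦm.aemeasurable hne ENNReal.ofReal_ne_top
      _ ≤ ENNReal.ofReal (Real.exp (ε / 2 * N)) / ENNReal.ofReal (Real.exp (ε * N)) := by
          gcongr
      _ = ENNReal.ofReal (Real.exp (-(ε / 2) * N)) := by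
          rw [← ENNReal.ofReal_div_of_pos (Real.exp_pos _), ← Real.exp_sub]
          congr 2; ring
  have tsum := ((t1.add t2).add t3).add t4
  rw [add_zero, add_zero, add_zero] at tsum
  refine tendsto_of_tendsto_of_tendsto_of_le_of_le' tendsto_const_nhds tsum
    (Eventually.of_forall fun _ => zero_le) ?_
  filter_upwards [hmN, eventually_ge_atTop 1,
    eventually_gibbs_le_avgLogLik m hm hmN hs0 hε hsT hsL] with N hN hN1 hlow
  refine le_trans (measure_mono_ae ?_) ((measure_union_le _ _).trans
    (add_le_add_left ((measure_union_le _ _).trans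
      (add_le_add_left (measure_union_le _ _) _)) _))
  filter_upwards [hinj N] with ω hω hbad
  by_contra hgood
  have hN0 : (0:ℝ) < N := by exact_mod_cast hN1
  replace hgood : ω ∉ (_ ∪ _ ∪ _ ∪ _ : Set Ω) := hgood
  simp only [Set.mem_union, not_or] at hgood
  obtain ⟨⟨⟨g1, g2⟩, g3⟩, g4⟩ := hgood
  replace g1 : ¬ ε ≤ |_| := g1
  replace g1 := abs_lt.mp (not_le.mp g1)
  replace g2 : ¬ ε ≤ |_| := g2
  replace g2 := abs_lt.mp (not_le.mp g2)
  replace g3 : ¬ ε ≤ |_| := g3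
  replace g3 := abs_lt.mp (not_le.mp g3)
  replace g4 : ¬ ε * N ≤ _ := g4
  replace g4 := not_le.mp g4
  replace hbad : ε₀ ≤ |_| := hbad
  rw [estimator_eq _ hω hN hN1] at hbad
  have hl := hlow (x N ω) (Y N ω) hω
  have hu : avgLogLik (m N) (x N ω) (Y N ω) / N
      < ε + (∑ i, Real.log (f (x N ω i) (Y N ω i))) / N := by
    rw [div_lt_iff₀ hN0, add_mul, div_mul_cancel₀ _ hN0.ne']
    have : logPosterior f (x N ω) (Y N ω) = ∑ i, Real.log (f (x N ω i) (Y N ω i)) := rfl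
    linarith
  refine absurd hbad (not_le.mpr (abs_lt.mpr ⟨?_, ?_⟩)) <;> linarith

end Consistency

/-! ### Mutual information of the joint law -/

section MutualInformation

variable {K : ℕ} {p : Fin K → ℝ} {ν : Fin K → Measure ℝ} {f : Fin K → ℝ → ℝ}
  [∀ g, IsProbabilityMeasure (ν g)]

lemma lintegral_jointLaw {F : Fin K × ℝ → ENNReal} (hF : Measurable F) :
    ∫⁻ z, F z ∂(jointLaw p ν) = ∑ g, ENNReal.ofReal (p g) * ∫⁻ y, F (g, y) ∂(ν g) := by
  unfold jointLaw
  rw [lintegral_finsetSum_measure]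
  refine Finset.sum_congr rfl fun g _ => ?_
  rw [lintegral_smul_measure, Measure.dirac_prod, lintegral_map hF measurable_prodMk_left,
    smul_eq_mul]

lemma jointLaw_apply {s : Set (Fin K × ℝ)} (hs : MeasurableSet s) :
    jointLaw p ν s = ∑ g, ENNReal.ofReal (p g) * ν g (Prod.mk g ⁻¹' s) := by
  rw [← lintegral_indicator_one hs, lintegral_jointLaw (measurable_one.indicator hs)]
  refine Finset.sum_congr rfl fun g _ => ?_
  rw [← lintegral_indicator_one (measurable_prodMk_left hs)]
  rfl

lemma fst_jointLaw :
    (jointLaw p ν).fst = ∑ g, ENNReal.ofReal (p g) • Measure.dirac g := by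
  ext s hs
  rw [Measure.fst_apply hs, jointLaw_apply (measurable_fst hs), Measure.coe_finsetSum,
    Finset.sum_apply]
  refine Finset.sum_congr rfl fun g _ => ?_
  rw [Measure.smul_apply, smul_eq_mul, Measure.dirac_apply' _ hs]
  by_cases h : g ∈ s
  · have : Prod.mk g ⁻¹' (Prod.fst ⁻¹' s) = (Set.univ : Set ℝ) := by ext; simp [h]
    simp [this, h]
  · have : Prod.mk g ⁻¹' (Prod.fst ⁻¹' s) = (∅ : Set ℝ) := by ext; simp [h]
    simp [this, h]

lemma snd_jointLaw : (jointLaw p ν).snd = mixture p ν := by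
  ext s hs
  rw [Measure.snd_apply hs, jointLaw_apply (measurable_snd hs), mixture, Measure.coe_finsetSum,
    Finset.sum_apply]
  rfl

lemma isProbabilityMeasure_jointLaw (hp : ∀ g, 0 < p g) (hp1 : ∑ g, p g = 1) :
    IsProbabilityMeasure (jointLaw p ν) := by
  constructor
  rw [jointLaw_apply MeasurableSet.univ]
  simp only [Set.preimage_univ, measure_univ, mul_one]
  rw [← ENNReal.ofReal_sum_of_nonneg fun g _ => (hp g).le, hp1, ENNReal.ofReal_one]

lemma integrable_jointLaw {F : Fin K × ℝ → ℝ} (hF : Measurable F)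
    (hi : ∀ g, Integrable (fun y => F (g, y)) (ν g)) : Integrable F (jointLaw p ν) := by
  unfold jointLaw
  refine integrable_finsetSum_measure.mpr fun g _ => ?_
  refine Integrable.smul_measure ?_ ENNReal.ofReal_ne_top
  rw [Measure.dirac_prod]
  exact (integrable_map_measure hF.aestronglyMeasurable measurable_prodMk_left.aemeasurable).mpr
    (hi g)

lemma integral_jointLaw (hp : ∀ g, 0 < p g) {F : Fin K × ℝ → ℝ} (hF : Measurable F)
    (hi : ∀ g, Integrable (fun y => F (g, y)) (ν g)) :
    ∫ z, F z ∂(jointLaw p ν) = ∑ g, p g * ∫ y, F (g, y) ∂(ν g) := by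
  unfold jointLaw
  rw [integral_finsetSum_measure]
  · refine Finset.sum_congr rfl fun g _ => ?_
    rw [integral_smul_measure, Measure.dirac_prod,
      integral_map measurable_prodMk_left.aemeasurable hF.aestronglyMeasurable,
      ENNReal.toReal_ofReal (hp g).le, smul_eq_mul]
  · exact integrable_finsetSum_measure.mp (integrable_jointLaw hF hi)

namespace IsPosterior

variable (hf : IsPosterior p ν f)
include hf

omit [∀ g, IsProbabilityMeasure (ν g)] in
lemma measurable_uncurry : Measurable fun z : Fin K × ℝ => f z.1 z.2 :=
  measurable_from_prod_countable_right hf.measurable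

/-- Bayes' rule: the density against the product of the marginals is posterior over prior. Its
logarithm is the integrand of the mutual information. -/
lemma jointLaw_eq_withDensity (hp : ∀ g, 0 < p g) :
    jointLaw p ν = ((jointLaw p ν).fst.prod (jointLaw p ν).snd).withDensity
      fun z => ENNReal.ofReal (f z.1 z.2 / p z.1) := by
  have hmeas : Measurable fun z : Fin K × ℝ => ENNReal.ofReal (f z.1 z.2 / p z.1) :=
    (hf.measurable_uncurry.div ((Measurable.of_discrete (f := p)).comp
      measurable_fst)).ennreal_ofReal
  rw [fst_jointLaw, snd_jointLaw]
  refine Measure.ext_of_lintegral _ fun F hF => ?_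
  rw [lintegral_withDensity_eq_lintegral_mul _ hmeas hF,
    lintegral_prod _ (hmeas.mul hF).aemeasurable, lintegral_finsetSum_measure,
    lintegral_jointLaw hF]
  refine Finset.sum_congr rfl fun g _ => ?_
  rw [lintegral_smul_measure, lintegral_dirac, smul_eq_mul,
    hf.mul_lintegral g (F := fun y => F (g, y)) (hF.comp measurable_prodMk_left), ← lintegral_const_mul]
  · refine lintegral_congr fun y => ?_
    simp only [Pi.mul_apply]
    rw [← mul_assoc, ← ENNReal.ofReal_mul (hp g).le, mul_div_cancel₀ _ (hp g).ne']
  · exact (hmeas.mul hF).comp measurable_prodMk_left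

/-- The mutual information as the entropy of the category minus its conditional entropy. -/
theorem mutualInfo_jointLaw (hp : ∀ g, 0 < p g) (hp1 : ∑ g, p g = 1) :
    mutualInfo (jointLaw p ν) ≠ ⊤ ∧ (mutualInfo (jointLaw p ν)).toReal
      = ∑ g, p g * ∫ y, Real.log (f g y) ∂(ν g) - ∑ g, p g * Real.log (p g) := by
  have := isProbabilityMeasure_jointLaw (ν := ν) hp hp1
  set ρ := jointLaw p ν with hρ
  have hmeas : Measurable fun z : Fin K × ℝ => f z.1 z.2 / p z.1 :=
    hf.measurable_uncurry.div ((Measurable.of_discrete (f := p)).comp measurable_fst)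
  have heq := hf.jointLaw_eq_withDensity hp
  rw [← hρ] at heq
  have hac : ρ ≪ ρ.fst.prod ρ.snd := by
    conv_lhs => rw [heq]
    exact withDensity_absolutelyContinuous _ _
  have hrn : ρ.rnDeriv (ρ.fst.prod ρ.snd)
      =ᵐ[ρ.fst.prod ρ.snd] fun z => ENNReal.ofReal (f z.1 z.2 / p z.1) := by
    have h := Measure.rnDeriv_withDensity (ρ.fst.prod ρ.snd) hmeas.ennreal_ofReal
    rwa [← heq] at h
  have hllr : llr ρ (ρ.fst.prod ρ.snd) =ᵐ[ρ] fun z => Real.log (f z.1 z.2 / p z.1) := by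
    filter_upwards [hac.ae_le hrn] with z hz
    rw [llr, hz, ENNReal.toReal_ofReal (div_nonneg (hf.nonneg _ _) (hp _).le)]
  have hlm : Measurable fun z : Fin K × ℝ => Real.log (f z.1 z.2 / p z.1) :=
    Real.measurable_log.comp hmeas
  have hlog : ∀ g, (fun y => Real.log (f g y / p g))
      =ᵐ[ν g] fun y => Real.log (f g y) - Real.log (p g) := fun g => by
    filter_upwards [hf.ae_pos hp g] with y hy
    exact Real.log_div hy.ne' (hp g).ne'
  have hli : ∀ g, Integrable (fun y => Real.log (f g y / p g)) (ν g) := fun g =>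
    (((hf.integrable_log hp g).sub (integrable_const _)).congr (hlog g).symm)
  have hint : Integrable (llr ρ (ρ.fst.prod ρ.snd)) ρ :=
    (integrable_jointLaw hlm hli).congr hllr.symm
  refine ⟨klDiv_ne_top hac hint, ?_⟩
  rw [mutualInfo, toReal_klDiv_of_measure_eq hac (by simp), integral_congr_ae hllr,
    integral_jointLaw hp hlm hli, ← Finset.sum_sub_distrib]
  refine Finset.sum_congr rfl fun g _ => ?_
  simp only
  rw [integral_congr_ae (hlog g), integral_sub (hf.integrable_log hp g) (integrable_const _)]
  simp
  ring

end IsPosterior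

end MutualInformation

/-! ### Change of measure and exchangeability -/

section Product

variable {K N : ℕ} {p : Fin K → ℝ} {ν : Fin K → Measure ℝ} {f : Fin K → ℝ → ℝ}
  [∀ g, IsProbabilityMeasure (ν g)]

instance (g : Fin K) : IsFiniteMeasure (ENNReal.ofReal (p g) • ν g) :=
  Measure.smul_finite _ ENNReal.ofReal_ne_top

lemma pi_smul_eq (p : Fin K → ℝ) (ν : Fin K → Measure ℝ) [∀ g, IsProbabilityMeasure (ν g)]
    (x : Fin N → Fin K) :
    Measure.pi (fun i => ENNReal.ofReal (p (x i)) • ν (x i))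
      = (∏ i, ENNReal.ofReal (p (x i))) • Measure.pi fun i => ν (x i) := by
  refine Measure.pi_eq fun s hs => ?_
  rw [Measure.smul_apply, Measure.pi_pi, smul_eq_mul, ← Finset.prod_mul_distrib]
  rfl

lemma map_comp_perm_pi (ρ : Measure ℝ) [IsFiniteMeasure ρ] (σ : Equiv.Perm (Fin N)) :
    (Measure.pi fun _ : Fin N => ρ).map (fun y => y ∘ σ) = Measure.pi fun _ : Fin N => ρ := by
  have hm : Measurable fun y : Fin N → ℝ => y ∘ σ :=
    measurable_pi_iff.mpr fun i => measurable_pi_apply (σ i)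
  refine (Measure.pi_eq fun s hs => ?_).symm
  rw [Measure.map_apply hm (MeasurableSet.univ_pi hs)]
  have : (fun y : Fin N → ℝ => y ∘ σ) ⁻¹' (Set.univ.pi s)
      = Set.univ.pi fun i => s (σ.symm i) := by
    ext y
    simp only [Set.mem_preimage, Set.mem_univ_pi, Function.comp_apply]
    exact ⟨fun h i => by simpa using h (σ.symm i), fun h i => by simpa using h (σ i)⟩
  rw [this, Measure.pi_pi]
  exact Equiv.prod_comp σ.symm fun i => ρ (s i)

lemma lintegral_pi_prod (ρ : Measure ℝ) [IsProbabilityMeasure ρ] {F : Fin N → ℝ → ENNReal}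
    (hF : ∀ i, Measurable (F i)) :
    ∫⁻ y, ∏ i, F i (y i) ∂(Measure.pi fun _ : Fin N => ρ) = ∏ i, ∫⁻ t, F i t ∂ρ := by
  have hind : iIndepFun (fun i (y : Fin N → ℝ) => F i (y i)) (Measure.pi fun _ : Fin N => ρ) :=
    iIndepFun_pi fun i => (hF i).aemeasurable
  rw [lintegral_prod_eq_prod_lintegral_of_indepFun _ _ hind
    fun i => (hF i).comp (measurable_pi_apply i)]
  refine Finset.prod_congr rfl fun i _ => ?_
  exact (measurePreserving_eval (fun _ : Fin N => ρ) i).lintegral_comp (hF i)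

namespace IsPosterior

variable (hf : IsPosterior p ν f)
include hf

lemma pi_eq_withDensity (hp : ∀ g, 0 < p g) (hp1 : ∑ g, p g = 1) (x : Fin N → Fin K) :
    Measure.pi (fun i => ENNReal.ofReal (p (x i)) • ν (x i))
      = (Measure.pi fun _ : Fin N => mixture p ν).withDensity
        fun y => ∏ i, ENNReal.ofReal (f (x i) (y i)) := by
  have := isProbabilityMeasure_mixture (ν := ν) hp hp1
  refine Measure.pi_eq fun s hs => ?_
  rw [withDensity_apply _ (MeasurableSet.univ_pi hs),
    ← lintegral_indicator (MeasurableSet.univ_pi hs)]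
  have e : ∀ y : Fin N → ℝ, (Set.univ.pi s).indicator
      (fun y => ∏ i, ENNReal.ofReal (f (x i) (y i))) y
      = ∏ i, (s i).indicator (fun t => ENNReal.ofReal (f (x i) t)) (y i) := by
    intro y
    by_cases hy : y ∈ Set.univ.pi s
    · rw [Set.indicator_of_mem hy]
      refine Finset.prod_congr rfl fun i _ => ?_
      rw [Set.indicator_of_mem (hy i (Set.mem_univ i))]
    · rw [Set.indicator_of_notMem hy]
      simp only [Set.mem_univ_pi, not_forall] at hy
      obtain ⟨i, hi⟩ := hy
      exact (Finset.prod_eq_zero (Finset.mem_univ i) (Set.indicator_of_notMem hi _)).symm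
  simp only [e]
  rw [lintegral_pi_prod (mixture p ν) fun i =>
    ((hf.measurable (x i)).ennreal_ofReal).indicator (hs i)]
  refine Finset.prod_congr rfl fun i _ => ?_
  rw [lintegral_indicator (hs i), hf.withDensity_eq (x i), withDensity_apply _ (hs i)]

/-- The density of the true law against the mixture product is the posterior likelihood, which
cancels `exp (-logPosterior)`. -/
lemma lintegral_exp_sub_logPosterior_le (hp : ∀ g, 0 < p g) (hp1 : ∑ g, p g = 1)
    (x : Fin N → Fin K) {G : (Fin N → ℝ) → ℝ} (hG : Measurable G) :
    ∫⁻ y, ENNReal.ofReal (Real.exp (G y - logPosterior f x y))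
        ∂(Measure.pi fun i => ENNReal.ofReal (p (x i)) • ν (x i))
      ≤ ∫⁻ y, ENNReal.ofReal (Real.exp (G y)) ∂(Measure.pi fun _ : Fin N => mixture p ν) := by
  have hV : Measurable fun y => logPosterior f x y :=
    (measurable_sum_apply hf.measurable_log).comp (measurable_const.prodMk measurable_id)
  have hd : Measurable fun y : Fin N → ℝ => ∏ i, ENNReal.ofReal (f (x i) (y i)) :=
    Finset.measurable_fun_prod _ fun i _ =>
      ((hf.measurable (x i)).comp (measurable_pi_apply i)).ennreal_ofReal
  have hE : Measurable fun y : Fin N → ℝ =>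
      ENNReal.ofReal (Real.exp (G y - logPosterior f x y)) :=
    (Real.measurable_exp.comp (hG.sub hV)).ennreal_ofReal
  rw [hf.pi_eq_withDensity hp hp1 x, lintegral_withDensity_eq_lintegral_mul _ hd hE]
  refine lintegral_mono fun y => ?_
  simp only [Pi.mul_apply]
  rw [← ENNReal.ofReal_prod_of_nonneg fun i _ => hf.nonneg _ _,
    ← ENNReal.ofReal_mul (Finset.prod_nonneg fun i _ => hf.nonneg _ _)]
  refine ENNReal.ofReal_le_ofReal ?_
  rw [Real.exp_sub, logPosterior, Real.exp_sum, mul_div_assoc', mul_comm, mul_div_assoc,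
    ← Finset.prod_div_distrib]
  refine mul_le_of_le_one_right (Real.exp_pos _).le (Finset.prod_le_one (fun i _ => ?_) fun i _ => ?_)
  · exact div_nonneg (hf.nonneg _ _) (Real.exp_pos _).le
  · rw [div_le_one (Real.exp_pos _)]
    -- Not an equality: at a zero of `f` the convention `Real.log 0 = 0` makes the right side 1.
    exact Real.le_exp_log _

end IsPosterior

/-- The bound on types holds for every `y`, so summing over labelings before integrating gives a
bound independent of `ρ`. -/
lemma sum_lintegral_condLogLik_le (ρ : Measure ℝ) [IsProbabilityMeasure ρ] {I : Finset ℕ} {m : ℕ}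
    (hm : 1 ≤ m) (hI : I ∈ partitions N m) {δ : ℝ} (hδ : 0 < δ) (hδ1 : δ ≤ 1) :
    ∑ x : Fin N → Fin K, ∫⁻ y, ENNReal.ofReal (Real.exp (condLogLik (cellLabel I y) x))
        ∂(Measure.pi fun _ : Fin N => ρ)
      ≤ ENNReal.ofReal (Real.exp (K * (δ * N + m * Real.log (1 / δ)))) := by
  have hmeas : ∀ x : Fin N → Fin K, Measurable fun y =>
      ENNReal.ofReal (Real.exp (condLogLik (cellLabel I y) x)) := fun x =>
    (Real.measurable_exp.comp (measurable_condLogLik_right I x)).ennreal_ofReal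
  rw [← lintegral_finsetSum _ fun x _ => hmeas x]
  calc _ ≤ ∫⁻ _, ENNReal.ofReal (Real.exp (K * (δ * N + m * Real.log (1 / δ))))
        ∂(Measure.pi fun _ : Fin N => ρ) := by
        refine lintegral_mono fun y => ?_
        simp only
        rw [← ENNReal.ofReal_sum_of_nonneg fun x _ => (Real.exp_pos _).le]
        exact ENNReal.ofReal_le_ofReal (sum_exp_condLogLik_le_exp _ (cells N I)
          (cellLabel_mem I y) hδ hδ1
          (card_cells_le_of_mem_partitions hm hI))
    _ = _ := by simp

/-- The nonempty fibres of `σ ↦ x ∘ σ` are cosets of the stabilizer of `x`, which has `∏ N_g!`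
elements. -/
lemma sum_comp_perm_le (x : Fin N → Fin K) (Φ : (Fin N → Fin K) → ENNReal) :
    ∑ σ : Equiv.Perm (Fin N), Φ (x ∘ σ)
      ≤ (∏ g, (groupCount x g).factorial : ℕ) * ∑ x', Φ x' := by
  classical
  have hstab : Fintype.card {σ : Equiv.Perm (Fin N) // x ∘ σ = x}
      = ∏ g, (groupCount x g).factorial := by
    rw [DomMulAct.stabilizer_card]
    refine Finset.prod_congr rfl fun g _ => ?_
    rw [groupCount, Fintype.card_subtype]
  rw [← Finset.sum_fiberwise_of_maps_to (g := fun σ : Equiv.Perm (Fin N) => x ∘ σ)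
    (t := Finset.univ) (fun _ _ => Finset.mem_univ _), Finset.mul_sum]
  refine Finset.sum_le_sum fun x' _ => ?_
  rw [Finset.sum_congr rfl (g := fun _ => Φ x')
    (fun σ hσ => by rw [(Finset.mem_filter.mp hσ).2]), Finset.sum_const, nsmul_eq_mul]
  gcongr
  rw [← hstab, Fintype.card_subtype]
  rcases Finset.eq_empty_or_nonempty
    (Finset.univ.filter fun σ : Equiv.Perm (Fin N) => x ∘ σ = x') with h | ⟨σ₀, h₀⟩
  · rw [h]; simp
  · replace h₀ := (Finset.mem_filter.mp h₀).2
    refine Finset.card_le_card_of_injOn (fun σ => σ * σ₀⁻¹) ?_ ?_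
    · intro σ hσ
      have hσ' : x ∘ σ = x' := by simpa using hσ
      simp only [Finset.coe_filter, Finset.mem_univ, true_and, Set.mem_ofPred_eq]
      ext1 i
      have h1 := congrFun (hσ'.trans h₀.symm) (σ₀⁻¹ i)
      simpa using h1
    · intro σ _ τ _ h
      exact mul_right_cancel h

/-- For identically distributed values the integral is the same for all rearrangements of `x`. So
`N!` copies of it form a sum over permutations, which the sum over all labelings bounds. -/
lemma factorial_mul_lintegral_condLogLik_le (ρ : Measure ℝ) [IsProbabilityMeasure ρ]
    {I : Finset ℕ} {m : ℕ} (hm : 1 ≤ m) (hI : I ∈ partitions N m) {δ : ℝ} (hδ : 0 < δ)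
    (hδ1 : δ ≤ 1) (x : Fin N → Fin K) :
    (N.factorial : ENNReal) * ∫⁻ y, ENNReal.ofReal (Real.exp (condLogLik (cellLabel I y) x))
        ∂(Measure.pi fun _ : Fin N => ρ)
      ≤ (∏ g, (groupCount x g).factorial : ℕ)
        * ENNReal.ofReal (Real.exp (K * (δ * N + m * Real.log (1 / δ)))) := by
  have hmeas : ∀ x : Fin N → Fin K, Measurable fun y =>
      ENNReal.ofReal (Real.exp (condLogLik (cellLabel I y) x)) := fun x =>
    (Real.measurable_exp.comp (measurable_condLogLik_right I x)).ennreal_ofReal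
  have hσ : ∀ σ : Equiv.Perm (Fin N),
      ∫⁻ y, ENNReal.ofReal (Real.exp (condLogLik (cellLabel I y) (x ∘ σ)))
        ∂(Measure.pi fun _ : Fin N => ρ)
      = ∫⁻ y, ENNReal.ofReal (Real.exp (condLogLik (cellLabel I y) x))
        ∂(Measure.pi fun _ : Fin N => ρ) := by
    intro σ
    have hm : Measurable fun y : Fin N → ℝ => y ∘ σ :=
      measurable_pi_iff.mpr fun i => measurable_pi_apply (σ i)
    conv_lhs => rw [← map_comp_perm_pi ρ σ]
    rw [lintegral_map (hmeas _) hm]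
    simp only [cellLabel_comp_perm, condLogLik_comp_perm]
  have hcard : (N.factorial : ENNReal) = ∑ _σ : Equiv.Perm (Fin N), 1 := by
    simp [Fintype.card_perm]
  rw [hcard, Finset.sum_mul, Finset.sum_congr rfl fun σ _ => (one_mul _).trans (hσ σ).symm]
  refine (sum_comp_perm_le x fun x' => ∫⁻ y, ENNReal.ofReal (Real.exp
    (condLogLik (cellLabel I y) x')) ∂(Measure.pi fun _ : Fin N => ρ)).trans ?_
  gcongr
  exact sum_lintegral_condLogLik_le ρ hm hI hδ hδ1

end Product

/-! ### Stirling-type bounds -/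

section Factorial

lemma log_factorial_le (n : ℕ) :
    Real.log n.factorial ≤ n * Real.log n - n + 1 + Real.log (n + 1) := by
  rcases Nat.eq_zero_or_pos n with rfl | hn
  · simp
  have key : ∀ n : ℕ, 1 ≤ n →
      Real.log n.factorial ≤ n * Real.log n - n + 1 + Real.log n := by
    intro n hn
    induction n, hn using Nat.le_induction with
    | base => simp
    | succ n hn ih =>
      have hn' : (0:ℝ) < n := by exact_mod_cast hn
      rw [Nat.factorial_succ, Nat.cast_mul, Real.log_mul (by positivity) (by positivity)]
      have h := Real.one_sub_inv_le_log_of_pos (x := (n + 1 : ℝ) / n) (by positivity)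
      rw [Real.log_div (by positivity) hn'.ne', inv_div] at h
      have h2 : 1 - (n:ℝ) / (n + 1) = 1 / (n + 1) := by field_simp; ring
      rw [h2, div_le_iff₀ (by positivity)] at h
      push_cast
      nlinarith
  refine (key n hn).trans ?_
  have : Real.log n ≤ Real.log (n + 1) := Real.log_le_log (by positivity) (by linarith)
  linarith

lemma le_log_factorial (n : ℕ) : n * Real.log n - n ≤ Real.log n.factorial := by
  rcases Nat.eq_zero_or_pos n with rfl | hn
  · simp
  have hn' : (0:ℝ) < n := by exact_mod_cast hn
  -- One term of the exponential series at `n`: `n ^ n / n! ≤ exp n`.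
  have h := Real.pow_div_factorial_le_exp (x := n) hn'.le n
  have h2 := Real.log_le_log (by positivity) h
  rw [Real.log_exp, Real.log_div (by positivity) (by positivity), Real.log_pow] at h2
  linarith

end Factorial

/-! ### Subexponential size of the error factors -/

section Exponents

lemma exists_mul_log_le (K : ℕ) {m : ℕ → ℕ}
    (hmN : Tendsto (fun N : ℕ => (m N : ℝ) / (N : ℝ)) atTop (𝓝 0)) {δ : ℝ} (hδ : 0 < δ) :
    ∃ η : ℝ, 0 < η ∧ η ≤ 1 ∧
      ∀ᶠ N : ℕ in atTop, K * (η * N + m N * Real.log (1 / η)) ≤ δ * N := by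
  -- Half of `δ N` pays for `K η N`. With `η` now fixed, `m / N → 0` lets the other half pay for `K
  -- m log (1 / η)`.
  set η := min 1 (δ / (2 * (K + 1))) with hη
  have hη0 : 0 < η := lt_min one_pos (by positivity)
  have hη1 : η ≤ 1 := min_le_left _ _
  have hL : 0 ≤ Real.log (1 / η) := Real.log_nonneg (by rw [le_div_iff₀ hη0]; linarith)
  refine ⟨η, hη0, hη1, ?_⟩
  have hKη : K * η ≤ δ / 2 := by
    have h1 : η ≤ δ / (2 * (K + 1)) := min_le_right _ _
    rw [le_div_iff₀ (by positivity)] at h1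
    nlinarith
  have hpos : 0 < δ / (2 * (K * Real.log (1 / η) + 1)) := by positivity
  filter_upwards [hmN.eventually (gt_mem_nhds hpos), eventually_ge_atTop 1] with N hN hN1
  have hN0 : (0:ℝ) < N := by exact_mod_cast hN1
  rw [div_lt_iff₀ hN0] at hN
  have h2 : K * Real.log (1 / η) * m N ≤ δ / 2 * N := by
    calc K * Real.log (1 / η) * m N
        ≤ (K * Real.log (1 / η) + 1) * (δ / (2 * (K * Real.log (1 / η) + 1)) * N) := by
          gcongr; linarith
      _ = δ / 2 * N := by field_simp
  nlinarith

lemma eventually_log_le (K : ℕ) {δ : ℝ} (hδ : 0 < δ) :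
    ∀ᶠ N : ℕ in atTop, K * (1 + Real.log (N + 1)) ≤ δ * N := by
  obtain ⟨η, hη0, hη1, hη⟩ := exists_mul_log_le K (m := fun _ => 1) (δ := δ / 2)
    (by simpa using tendsto_inv_atTop_nhds_zero_nat (𝕜 := ℝ)) (half_pos hδ)
  have h1 : Tendsto (fun N : ℕ => δ / 2 * (N : ℝ)) atTop atTop :=
    tendsto_natCast_atTop_atTop.const_mul_atTop (half_pos hδ)
  filter_upwards [hη, h1.eventually_ge_atTop (K : ℝ)] with N hN hN2
  have h2 := mul_le_mul_of_nonneg_left (log_one_add_le hη0 hη1 (x := N) (by positivity))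
    (show (0:ℝ) ≤ K by positivity)
  push_cast at hN
  linarith

end Exponents

/-! ### Almost sure absence of ties -/

section Ties

variable {Ω : Type*} [MeasurableSpace Ω] {μ : Measure Ω} [IsProbabilityMeasure μ]

lemma measure_eq_eq_zero {U V : Ω → ℝ} (hU : Measurable U) (hV : Measurable V)
    (h : IndepFun U V μ) (hat : ∀ t, μ {ω | V ω = t} = 0) : μ {ω | U ω = V ω} = 0 := by
  have h1 := (indepFun_iff_map_prod_eq_prod_map_map hU.aemeasurable hV.aemeasurable).mp h
  have h2 : μ {ω | U ω = V ω} = μ.map (fun ω => (U ω, V ω)) (Set.diagonal ℝ) := by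
    rw [Measure.map_apply (hU.prodMk hV) measurableSet_diagonal]; rfl
  rw [h2, h1, Measure.prod_apply measurableSet_diagonal]
  have h3 : ∀ u, μ.map V (Prod.mk u ⁻¹' Set.diagonal ℝ) = 0 := fun u => by
    rw [Measure.map_apply hV (measurable_prodMk_left measurableSet_diagonal)]
    refine (congrArg μ ?_).trans (hat u)
    ext ω
    simp [eq_comm]
  simp [h3]

lemma ae_injective {ι : Type*} [Countable ι] {Y : ι → Ω → ℝ} (hY : ∀ i, Measurable (Y i))
    (hind : Pairwise fun i j => IndepFun (Y i) (Y j) μ) (hat : ∀ i t, μ {ω | Y i ω = t} = 0) :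
    ∀ᵐ ω ∂μ, Function.Injective fun i => Y i ω := by
  have h : ∀ i j, i ≠ j → ∀ᵐ ω ∂μ, Y i ω ≠ Y j ω := fun i j hij => by
    rw [ae_iff]
    simp only [ne_eq, not_not]
    exact measure_eq_eq_zero (hY i) (hY j) (hind hij) (hat j)
  have h' : ∀ᵐ ω ∂μ, ∀ i j, i ≠ j → Y i ω ≠ Y j ω := by
    rw [ae_all_iff]; intro i
    rw [ae_all_iff]; intro j
    by_cases hij : i = j
    · exact ae_of_all _ fun _ h => absurd hij h
    · filter_upwards [h i j hij] with ω hω _ using hω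
  filter_upwards [h'] with ω hω i j hij
  by_contra hne
  exact hω i j hne hij

end Ties

/-! ### Independent samples with prescribed categories -/

section PrescribedCategories

variable {K : ℕ} {p : Fin K → ℝ} {ν : Fin K → Measure ℝ} {f : Fin K → ℝ → ℝ}
  [∀ g, IsProbabilityMeasure (ν g)]

lemma sum_eq_one_of_tendsto {x : (N : ℕ) → Fin N → Fin K}
    (h : ∀ g, Tendsto (fun N : ℕ => (groupCount (x N) g : ℝ) / (N : ℝ)) atTop (𝓝 (p g))) :
    ∑ g, p g = 1 := by
  refine tendsto_nhds_unique (tendsto_finsetSum Finset.univ fun g _ => h g) ?_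
  refine tendsto_const_nhds.congr' ?_
  filter_upwards [eventually_ge_atTop 1] with N hN
  have hN0 : (N:ℝ) ≠ 0 := by exact_mod_cast (by omega : N ≠ 0)
  have h1 := sum_groupCount_mul (x N) fun _ => 1
  simp only [mul_one, Finset.sum_const, Finset.card_univ, Fintype.card_fin, nsmul_eq_mul] at h1
  rw [← Finset.sum_div, h1, div_self hN0]

lemma IsPosterior.lintegral_prescribed_le (hf : IsPosterior p ν f) (hp : ∀ g, 0 < p g)
    (hp1 : ∑ g, p g = 1) {N m : ℕ} (hm : 1 ≤ m) {I : Finset ℕ} (hI : I ∈ partitions N m)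
    {η : ℝ} (hη : 0 < η) (hη1 : η ≤ 1) (x : Fin N → Fin K) {E : ℝ}
    (hE : ∑ g, Real.log (groupCount x g).factorial + K * (η * N + m * Real.log (1 / η))
      ≤ Real.log N.factorial + ∑ g, (groupCount x g : ℝ) * Real.log (p g) + E) :
    ∫⁻ y, ENNReal.ofReal (Real.exp (condLogLik (cellLabel I y) x - logPosterior f x y))
      ∂(Measure.pi fun i => ν (x i)) ≤ ENNReal.ofReal (Real.exp E) := by
  have := isProbabilityMeasure_mixture (ν := ν) hp hp1
  have hG : Measurable fun y : Fin N → ℝ => condLogLik (cellLabel I y) x :=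
    measurable_condLogLik_right I x
  have h1 := hf.lintegral_exp_sub_logPosterior_le hp hp1 x hG
  have h2 := factorial_mul_lintegral_condLogLik_le (mixture p ν) hm hI hη hη1 x
  rw [pi_smul_eq, lintegral_smul_measure, smul_eq_mul,
    ← ENNReal.ofReal_prod_of_nonneg fun i _ => (hp (x i)).le] at h1
  have hP : 0 < ∏ i, p (x i) := Finset.prod_pos fun i _ => hp _
  have hF : (0:ℝ) < N.factorial := by positivity
  have ha : 0 < (N.factorial : ℝ) * ∏ i, p (x i) := mul_pos hF hP
  -- The change of measure is combined with the permutation bound; afterwards the common factor `N!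
  -- ∏ p (x i)` is cancelled and all that remains is a comparison of exponents.
  have h3 := (mul_le_mul_right h1 (N.factorial : ENNReal)).trans h2
  rw [← mul_assoc, ← ENNReal.ofReal_natCast, ← ENNReal.ofReal_natCast,
    ← ENNReal.ofReal_mul hF.le, ← ENNReal.ofReal_mul (by positivity)] at h3
  refine (ENNReal.mul_le_mul_iff_right (a := ENNReal.ofReal (N.factorial * ∏ i, p (x i)))
    (ENNReal.ofReal_pos.mpr ha).ne' ENNReal.ofReal_ne_top).mp (h3.trans ?_)
  rw [← ENNReal.ofReal_mul ha.le]
  refine ENNReal.ofReal_le_ofReal ?_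
  have e1 : ((∏ g, (groupCount x g).factorial : ℕ) : ℝ)
      = Real.exp (∑ g, Real.log (groupCount x g).factorial) := by
    rw [Real.exp_sum, Nat.cast_prod]
    exact Finset.prod_congr rfl fun g _ => (Real.exp_log (by positivity)).symm
  have e2 : ∏ i, p (x i) = Real.exp (∑ g, (groupCount x g : ℝ) * Real.log (p g)) := by
    rw [sum_groupCount_mul x fun g => Real.log (p g), Real.exp_sum]
    exact Finset.prod_congr rfl fun i _ => (Real.exp_log (hp _)).symm
  rw [e1, e2, ← Real.exp_log hF, ← Real.exp_add, ← Real.exp_add, ← Real.exp_add]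
  exact Real.exp_le_exp.mpr hE

/-- By the factorial bounds, the logarithm of `∏ N_g! / (N! ∏ p_g ^ N_g)` is at most `N` times the
relative entropy of the frequencies `N_g / N` from `p`, up to `O(log N)`. That relative entropy
tends to 0. -/
lemma eventually_log_multinomial_le {x : (N : ℕ) → Fin N → Fin K}
    (h : ∀ g, Tendsto (fun N : ℕ => (groupCount (x N) g : ℝ) / (N : ℝ)) atTop (𝓝 (p g)))
    {δ : ℝ} (hδ : 0 < δ) :
    ∀ᶠ N : ℕ in atTop, ∑ g, Real.log (groupCount (x N) g).factorial
      ≤ Real.log N.factorial + ∑ g, (groupCount (x N) g : ℝ) * Real.log (p g) + δ * N := by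
  have hkl : Tendsto (fun N : ℕ => ∑ g, ((groupCount (x N) g : ℝ) / N
        * Real.log ((groupCount (x N) g : ℝ) / N)
        - (groupCount (x N) g : ℝ) / N * Real.log (p g))) atTop (𝓝 0) := by
    have : ∑ g, (p g * Real.log (p g) - p g * Real.log (p g)) = 0 := by simp
    rw [← this]
    refine tendsto_finsetSum _ fun g _ => ?_
    exact ((Real.continuous_mul_log.tendsto (p g)).comp (h g)).sub ((h g).mul_const _)
  filter_upwards [hkl.eventually (gt_mem_nhds (half_pos hδ)), eventually_ge_atTop 1,
    eventually_log_le K (half_pos hδ)] with N hN hN1 hlog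
  have hN0 : (0:ℝ) < N := by exact_mod_cast hN1
  have hcount : ∑ g, (groupCount (x N) g : ℝ) = N := by
    have h1 := sum_groupCount_mul (x N) fun _ => 1
    simpa using h1
  have hle : ∀ g, groupCount (x N) g ≤ N := fun g => by
    simpa [groupCount] using Finset.card_filter_le (Finset.univ : Finset (Fin N)) (x N · = g)
  have h1 : ∀ g, Real.log (groupCount (x N) g).factorial
      ≤ (groupCount (x N) g : ℝ) * Real.log (groupCount (x N) g) - groupCount (x N) g
        + (1 + Real.log (N + 1)) := fun g => by
    refine (log_factorial_le _).trans ?_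
    have : Real.log ((groupCount (x N) g : ℝ) + 1) ≤ Real.log (N + 1) :=
      Real.log_le_log (by positivity) (by have := hle g; gcongr)
    linarith
  have h2 : ∀ g, ((groupCount (x N) g : ℝ) / N * Real.log ((groupCount (x N) g : ℝ) / N)
      - (groupCount (x N) g : ℝ) / N * Real.log (p g)) * N
      = (groupCount (x N) g : ℝ) * Real.log (groupCount (x N) g)
        - (groupCount (x N) g : ℝ) * Real.log N - (groupCount (x N) g : ℝ) * Real.log (p g) := by
    intro g
    rcases Nat.eq_zero_or_pos (groupCount (x N) g) with h0 | h0
    · simp [h0]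
    · have : (0:ℝ) < groupCount (x N) g := by exact_mod_cast h0
      rw [Real.log_div this.ne' hN0.ne']
      field_simp
  have h3 := mul_lt_mul_of_pos_right hN hN0
  rw [Finset.sum_mul, Finset.sum_congr rfl fun g _ => h2 g, Finset.sum_sub_distrib,
    Finset.sum_sub_distrib, ← Finset.sum_mul, hcount] at h3
  have h4 := Finset.sum_le_sum fun g (_ : g ∈ Finset.univ) => h1 g
  rw [Finset.sum_add_distrib, Finset.sum_sub_distrib, hcount, Finset.sum_const, Finset.card_univ,
    Fintype.card_fin, nsmul_eq_mul] at h4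
  have h5 := le_log_factorial N
  linarith

variable {Ω : Type*} [MeasurableSpace Ω] {μ : Measure Ω} [IsProbabilityMeasure μ]

omit [∀ g, IsProbabilityMeasure (ν g)] in
/-- The weak law of large numbers for independent observations with prescribed categories. -/
lemma tendstoInMeasure_prescribed_average {x : (N : ℕ) → Fin N → Fin K}
    {Y : (N : ℕ) → Fin N → Ω → ℝ} (hY : ∀ N i, Measurable (Y N i))
    (hind : ∀ N, iIndepFun (Y N) μ) (hlaw : ∀ N i, μ.map (Y N i) = ν (x N i))
    (h : ∀ g, Tendsto (fun N : ℕ => (groupCount (x N) g : ℝ) / (N : ℝ)) atTop (𝓝 (p g)))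
    {ψ : Fin K → ℝ → ℝ} (hψ : ∀ g, Measurable (ψ g)) (hψ2 : ∀ g, MemLp (ψ g) 2 (ν g)) :
    TendstoInMeasure μ (fun (N : ℕ) ω => (∑ i, ψ (x N i) (Y N i ω)) / (N : ℝ)) atTop
      (fun _ => ∑ g, p g * ∫ y, ψ g y ∂(ν g)) := by
  rw [tendstoInMeasure_iff_dist]
  intro ε hε
  -- One variance bound for all observations. Chebyshev's inequality gets `ε / 2`; the other half
  -- absorbs the convergence of the mean.
  set M := ∑ g, ∫ y, ψ g y ^ 2 ∂(ν g) with hM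
  have hlim : Tendsto (fun N : ℕ => ENNReal.ofReal (4 * M / ε ^ 2 * (N : ℝ)⁻¹)) atTop (𝓝 0) := by
    rw [← ENNReal.ofReal_zero]
    refine ENNReal.tendsto_ofReal ?_
    simpa using (tendsto_inv_atTop_nhds_zero_nat (𝕜 := ℝ)).const_mul (4 * M / ε ^ 2)
  have hmean : Tendsto (fun N : ℕ => ∑ g, (groupCount (x N) g : ℝ) / N * ∫ y, ψ g y ∂(ν g)) atTop
      (𝓝 (∑ g, p g * ∫ y, ψ g y ∂(ν g))) :=
    tendsto_finsetSum _ fun g _ => (h g).mul_const _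
  refine tendsto_of_tendsto_of_tendsto_of_le_of_le' tendsto_const_nhds hlim
    (Eventually.of_forall fun _ => zero_le) ?_
  filter_upwards [Metric.tendsto_nhds.mp hmean (ε / 2) (half_pos hε),
    eventually_ge_atTop 1] with N hN hN1
  have hN0 : (0:ℝ) < N := by exact_mod_cast hN1
  let Z : Fin N → Ω → ℝ := fun i ω => ψ (x N i) (Y N i ω)
  have hZ2 : ∀ i, MemLp (Z i) 2 μ := fun i => by
    have := hψ2 (x N i)
    rw [← hlaw N i] at this
    exact (memLp_map_measure_iff (hψ _).aestronglyMeasurable (hY N i).aemeasurable).mp this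
  have hZE : ∀ i, ∫ ω, Z i ω ∂μ = ∫ y, ψ (x N i) y ∂(ν (x N i)) := fun i => by
    rw [← hlaw N i, integral_map (hY N i).aemeasurable (hψ _).aestronglyMeasurable]
  have hZV : ∀ i, variance (Z i) μ ≤ M := fun i => by
    refine (variance_le_expectation_sq (hZ2 i).aestronglyMeasurable).trans ?_
    have e : ∫ ω, (Z i ^ 2) ω ∂μ = ∫ y, ψ (x N i) y ^ 2 ∂(ν (x N i)) := by
      rw [← hlaw N i, integral_map (hY N i).aemeasurable
        ((hψ _).pow_const 2).aestronglyMeasurable]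
      rfl
    rw [e]
    exact Finset.single_le_sum (f := fun g => ∫ y, ψ g y ^ 2 ∂(ν g))
      (fun g _ => integral_nonneg fun _ => sq_nonneg _) (Finset.mem_univ _)
  have hZind : Set.Pairwise ↑(Finset.univ : Finset (Fin N)) fun i j => IndepFun (Z i) (Z j) μ :=
    fun i _ j _ hij => ((hind N).indepFun hij).comp (hψ _) (hψ _)
  have hvar : variance (∑ i, Z i) μ ≤ N * M := by
    rw [IndepFun.variance_sum (fun i _ => hZ2 i) hZind]
    refine (Finset.sum_le_sum fun i _ => hZV i).trans (le_of_eq ?_)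
    simp
  have hES : ∫ ω, (∑ i, Z i) ω ∂μ = ∑ g, (groupCount (x N) g : ℝ) * ∫ y, ψ g y ∂(ν g) := by
    simp only [Finset.sum_apply]
    rw [integral_finsetSum _ fun i _ => (hZ2 i).integrable (by norm_num),
      Finset.sum_congr rfl fun i _ => hZE i,
      sum_groupCount_mul (x N) fun g => ∫ y, ψ g y ∂(ν g)]
  have hcheb := meas_ge_le_variance_div_sq (memLp_finsetSum' Finset.univ fun i _ => hZ2 i)
    (show 0 < ε / 2 * N by positivity)
  refine (measure_mono fun ω hω => ?_).trans (hcheb.trans (ENNReal.ofReal_le_ofReal ?_))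
  · simp only [Set.mem_ofPred_eq] at hω ⊢
    rw [hES]
    rw [Real.dist_eq] at hω hN
    have e1 : ∑ g, (groupCount (x N) g : ℝ) / N * ∫ y, ψ g y ∂(ν g)
        = (∑ g, (groupCount (x N) g : ℝ) * ∫ y, ψ g y ∂(ν g)) / N := by
      rw [Finset.sum_div]; exact Finset.sum_congr rfl fun g _ => by ring
    rw [e1] at hN
    have e2 : (∑ i, Z i) ω = ∑ i, ψ (x N i) (Y N i ω) := by simp [Z]
    rw [e2]
    set S := ∑ i, ψ (x N i) (Y N i ω)
    set E := ∑ g, (groupCount (x N) g : ℝ) * ∫ y, ψ g y ∂(ν g)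
    have h3 : ε / 2 ≤ |S / N - E / N| := by
      have := abs_sub_le (S / N) (E / N) (∑ g, p g * ∫ y, ψ g y ∂(ν g))
      linarith
    rwa [← sub_div, abs_div, abs_of_pos hN0, le_div_iff₀ hN0] at h3
  · calc variance (∑ i, Z i) μ / (ε / 2 * N) ^ 2 ≤ N * M / (ε / 2 * N) ^ 2 := by gcongr
      _ = 4 * M / ε ^ 2 * (N : ℝ)⁻¹ := by field_simp; ring

/-- Consistency for independent samples of prescribed sizes. -/
theorem consistency_prescribed (m : ℕ → ℕ) (hm : Tendsto m atTop atTop)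
    (hmN : Tendsto (fun N : ℕ => (m N : ℝ) / (N : ℝ)) atTop (𝓝 0))
    {x : (N : ℕ) → Fin N → Fin K} {Y : (N : ℕ) → Fin N → Ω → ℝ}
    (hat : ∀ (g : Fin K) (t : ℝ), ν g {t} = 0) (hY : ∀ N i, Measurable (Y N i))
    (hind : ∀ N, iIndepFun (Y N) μ) (hlaw : ∀ N i, μ.map (Y N i) = ν (x N i))
    (hp : ∀ g, 0 < p g)
    (h : ∀ g, Tendsto (fun N : ℕ => (groupCount (x N) g : ℝ) / (N : ℝ)) atTop (𝓝 (p g))) :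
    mutualInfo (jointLaw p ν) ≠ ⊤ ∧
      TendstoInMeasure μ (fun (N : ℕ) ω => estimator (x N) (fun i : Fin N => Y N i ω) (m N))
        atTop (fun _ => (mutualInfo (jointLaw p ν)).toReal) := by
  obtain ⟨f, hf⟩ := exists_isPosterior p ν
  have hp1 := sum_eq_one_of_tendsto h
  obtain ⟨hfin, hval⟩ := hf.mutualInfo_jointLaw hp hp1
  refine ⟨hfin, ?_⟩
  rw [hval]
  have hmN' : ∀ᶠ N in atTop, m N ≤ N := by
    filter_upwards [hmN.eventually (gt_mem_nhds one_pos), eventually_ge_atTop 1] with N hN hN1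
    rw [div_lt_one (by exact_mod_cast hN1)] at hN
    exact_mod_cast hN.le
  refine tendstoInMeasure_estimator m hm hmN' hf hp hp1 (fun N _ => x N) (fun N ω i => Y N i ω)
    (fun N => measurable_const) (fun N => measurable_pi_iff.mpr (hY N)) (fun N => ?_)
    (fun g => ae_of_all _ fun _ => h g)
    (fun ψ hψ hψ2 => tendstoInMeasure_prescribed_average hY hind hlaw h hψ hψ2) ?_
  · refine ae_injective (hY N) (fun i j hij => (hind N).indepFun hij) fun i t => ?_
    rw [← hat (x N i) t, ← hlaw N i, Measure.map_apply (hY N i) (measurableSet_singleton t)]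
    rfl
  · intro δ hδ
    obtain ⟨η, hη, hη1, hηN⟩ := exists_mul_log_le K hmN (half_pos hδ)
    filter_upwards [hηN, eventually_log_multinomial_le h (half_pos hδ),
      hm.eventually_ge_atTop 1] with N hN1 hN2 hN3 I hI
    have hb := hf.lintegral_prescribed_le hp hp1 hN3 hI hη hη1 (x N) (E := δ * N) (by linarith)
    refine le_trans (le_of_eq ?_) hb
    have hmap : μ.map (fun ω i => Y N i ω) = Measure.pi fun i => ν (x N i) := by
      rw [(iIndepFun_iff_map_fun_eq_pi_map fun i => (hY N i).aemeasurable).mp (hind N)]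
      simp only [hlaw]
    have hmeas : Measurable fun y : Fin N → ℝ => ENNReal.ofReal (Real.exp
        (condLogLik (cellLabel I y) (x N) - logPosterior f (x N) y)) :=
      (Real.measurable_exp.comp (((measurable_condLogLik I).sub
        (measurable_sum_apply hf.measurable_log)).comp
          (measurable_const.prodMk measurable_id))).ennreal_ofReal
    rw [← hmap, lintegral_map hmeas (measurable_pi_iff.mpr (hY N))]

end PrescribedCategories

/-! ### Independent draws from a joint distribution -/

section RandomCategories

variable {K : ℕ}

/-- Disintegration over finitely many categories of positive probability: `ν g` is the elementary
conditional law of the value. It brings the first model into the form used for the second. -/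
lemma exists_jointLaw_eq (ρ : Measure (Fin K × ℝ)) [IsProbabilityMeasure ρ]
    (hρ : ∀ g, 0 < ρ.real (Prod.fst ⁻¹' {g})) :
    ∃ ν : Fin K → Measure ℝ, (∀ g, IsProbabilityMeasure (ν g)) ∧
      jointLaw (fun g => ρ.real (Prod.fst ⁻¹' {g})) ν = ρ := by
  have hm : ∀ g : Fin K, MeasurableSet (Prod.fst ⁻¹' {g} : Set (Fin K × ℝ)) := fun g =>
    measurable_fst (measurableSet_singleton g)
  have h0 : ∀ g, ρ (Prod.fst ⁻¹' {g}) ≠ 0 := fun g h => by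
    have := hρ g
    rw [measureReal_def, h] at this
    simp at this
  let ν : Fin K → Measure ℝ := fun g =>
    (ρ (Prod.fst ⁻¹' {g}))⁻¹ • (ρ.restrict (Prod.fst ⁻¹' {g})).map Prod.snd
  have hν : ∀ g, IsProbabilityMeasure (ν g) := fun g => ⟨by
    simp only [ν, Measure.smul_apply, smul_eq_mul]
    rw [Measure.map_apply measurable_snd MeasurableSet.univ, Set.preimage_univ,
      Measure.restrict_apply_univ, ENNReal.inv_mul_cancel (h0 g) (measure_ne_top _ _)]⟩
  refine ⟨ν, hν, ?_⟩
  ext s hs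
  rw [jointLaw_apply hs]
  have h1 : ∀ g, ENNReal.ofReal (ρ.real (Prod.fst ⁻¹' {g})) * ν g (Prod.mk g ⁻¹' s)
      = ρ (s ∩ Prod.fst ⁻¹' {g}) := fun g => by
    simp only [ν, Measure.smul_apply, smul_eq_mul]
    rw [ofReal_measureReal, ← mul_assoc, ENNReal.mul_inv_cancel (h0 g) (measure_ne_top _ _),
      one_mul, Measure.map_apply measurable_snd (measurable_prodMk_left hs),
      Measure.restrict_apply (measurable_snd (measurable_prodMk_left hs))]
    congr 1
    ext ⟨a, b⟩
    simp only [Set.mem_inter_iff, Set.mem_preimage, Set.mem_singleton_iff]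
    constructor
    · rintro ⟨h, rfl⟩; exact ⟨h, rfl⟩
    · rintro ⟨h, rfl⟩; exact ⟨h, rfl⟩
  rw [Finset.sum_congr rfl fun g _ => h1 g, ← measure_biUnion_finset]
  · congr 1
    ext z
    simp
  · intro g _ g' _ hne
    refine Set.disjoint_left.mpr ?_
    rintro z ⟨-, h⟩ ⟨-, h'⟩
    exact hne (h.symm.trans h')
  · exact fun g _ => hs.inter (hm g)

variable {p : Fin K → ℝ} {ν : Fin K → Measure ℝ} {f : Fin K → ℝ → ℝ}
  [∀ g, IsProbabilityMeasure (ν g)]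
  {Ω : Type*} [MeasurableSpace Ω] {μ : Measure Ω} [IsProbabilityMeasure μ]
  {X : ℕ → Ω → Fin K} {Y : ℕ → Ω → ℝ}

omit [IsProbabilityMeasure μ] in
-- On the event that the categories are `x`, independence makes the law of the values a product of
-- subprobability measures, with the probabilities `p (x i)` kept as weights.
lemma map_restrict_eq_pi (hX : ∀ i, Measurable (X i)) (hY : ∀ i, Measurable (Y i))
    (hind : iIndepFun (fun i ω => (X i ω, Y i ω)) μ)
    (hlaw : ∀ i, μ.map (fun ω => (X i ω, Y i ω)) = jointLaw p ν) {N : ℕ} (x : Fin N → Fin K) :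
    (μ.restrict {ω | (fun i : Fin N => X i ω) = x}).map (fun ω (i : Fin N) => Y i ω)
      = Measure.pi fun i => ENNReal.ofReal (p (x i)) • ν (x i) := by
  have hYm : Measurable fun ω (i : Fin N) => Y i ω := measurable_pi_iff.mpr fun i => hY i
  refine (Measure.pi_eq fun s hs => ?_).symm
  rw [Measure.map_apply hYm (MeasurableSet.univ_pi hs),
    Measure.restrict_apply (hYm (MeasurableSet.univ_pi hs))]
  have hset : (fun ω (i : Fin N) => Y i ω) ⁻¹' Set.univ.pi s
        ∩ {ω | (fun i : Fin N => X i ω) = x}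
      = ⋂ i ∈ (Finset.univ : Finset (Fin N)),
        (fun ω => (X i ω, Y i ω)) ⁻¹' ({x i} ×ˢ s i) := by
    ext ω
    simp only [Set.mem_inter_iff, Set.mem_preimage, Set.mem_univ_pi, Set.mem_ofPred_eq,
      Set.mem_iInter, Set.mem_prod, Set.mem_singleton_iff, Finset.mem_univ, true_imp_iff,
      funext_iff]
    exact ⟨fun h i => ⟨h.2 i, h.1 i⟩, fun h => ⟨fun i => (h i).2, fun i => (h i).1⟩⟩
  have hind' : iIndepFun (fun (i : Fin N) ω => (X i ω, Y i ω)) μ :=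
    hind.precomp Fin.val_injective
  rw [hset, hind'.measure_inter_preimage_eq_mul Finset.univ
    fun i _ => (measurableSet_singleton (x i)).prod (hs i)]
  refine Finset.prod_congr rfl fun i _ => ?_
  have hms := (measurableSet_singleton (x i)).prod (hs i)
  rw [← Measure.map_apply ((hX i).prodMk (hY i)) hms, hlaw i, jointLaw_apply hms,
    Finset.sum_eq_single (x i)]
  · rw [Measure.smul_apply, smul_eq_mul]
    congr 2
    ext; simp
  · intro g _ hg
    have : Prod.mk g ⁻¹' ({x i} ×ˢ s i) = (∅ : Set ℝ) := by ext; simp [hg]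
    rw [this]; simp
  · simp

omit [IsProbabilityMeasure μ] in
lemma lintegral_eq_sum_pi (hX : ∀ i, Measurable (X i)) (hY : ∀ i, Measurable (Y i))
    (hind : iIndepFun (fun i ω => (X i ω, Y i ω)) μ)
    (hlaw : ∀ i, μ.map (fun ω => (X i ω, Y i ω)) = jointLaw p ν) {N : ℕ}
    (H : (Fin N → Fin K) → (Fin N → ℝ) → ENNReal) (hH : ∀ x, Measurable (H x)) :
    ∫⁻ ω, H (fun i => X i ω) (fun i => Y i ω) ∂μ
      = ∑ x, ∫⁻ y, H x y ∂(Measure.pi fun i => ENNReal.ofReal (p (x i)) • ν (x i)) := by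
  have hXm : Measurable fun ω (i : Fin N) => X i ω := measurable_pi_iff.mpr fun i => hX i
  have hYm : Measurable fun ω (i : Fin N) => Y i ω := measurable_pi_iff.mpr fun i => hY i
  have hms : ∀ x : Fin N → Fin K, MeasurableSet {ω | (fun i : Fin N => X i ω) = x} := fun x =>
    hXm (measurableSet_singleton x)
  have hun : (⋃ x : Fin N → Fin K, {ω | (fun i : Fin N => X i ω) = x}) = Set.univ := by
    ext ω; simp
  rw [← setLIntegral_univ, ← hun, lintegral_iUnion hms, tsum_fintype]
  · refine Finset.sum_congr rfl fun x _ => ?_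
    rw [← map_restrict_eq_pi hX hY hind hlaw x, lintegral_map (hH x) hYm]
    refine setLIntegral_congr_fun (hms x) fun ω hω => ?_
    have : (fun i : Fin N => X i ω) = x := hω
    simp only [this]
  · intro x x' hne
    refine Set.disjoint_left.mpr fun ω h h' => hne ?_
    exact (show (fun i : Fin N => X i ω) = x from h).symm.trans h'

omit [IsProbabilityMeasure μ] in
/-- The strong law of large numbers for functions of independent draws of `(X, Y)`. -/
lemma ae_tendsto_average (hX : ∀ i, Measurable (X i)) (hY : ∀ i, Measurable (Y i))
    (hind : iIndepFun (fun i ω => (X i ω, Y i ω)) μ)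
    (hid : ∀ i, IdentDistrib (fun ω => (X i ω, Y i ω)) (fun ω => (X 0 ω, Y 0 ω)) μ μ)
    {F : Fin K × ℝ → ℝ} (hF : Measurable F)
    (hi : Integrable F (μ.map fun ω => (X 0 ω, Y 0 ω))) :
    ∀ᵐ ω ∂μ, Tendsto (fun N : ℕ => (∑ i : Fin N, F (X i ω, Y i ω)) / (N : ℝ)) atTop
      (𝓝 (∫ z, F z ∂(μ.map fun ω => (X 0 ω, Y 0 ω)))) := by
  have hm0 : Measurable fun ω => (X 0 ω, Y 0 ω) := (hX 0).prodMk (hY 0)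
  have h := strong_law_ae_real (μ := μ) (fun i ω => F (X i ω, Y i ω))
    ((integrable_map_measure hF.aestronglyMeasurable hm0.aemeasurable).mp hi)
    (fun i j hij => (hind.indepFun hij).comp hF hF) (fun i => (hid i).comp hF)
  rw [integral_map hm0.aemeasurable hF.aestronglyMeasurable]
  filter_upwards [h] with ω hω
  simpa only [Finset.sum_range] using hω

/-- Consistency for independent draws from a joint distribution. -/
theorem consistency_draws (m : ℕ → ℕ) (hm : Tendsto m atTop atTop)
    (hmN : Tendsto (fun N : ℕ => (m N : ℝ) / (N : ℝ)) atTop (𝓝 0))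
    (hX : ∀ i, Measurable (X i)) (hY : ∀ i, Measurable (Y i))
    (hind : iIndepFun (fun i ω => (X i ω, Y i ω)) μ)
    (hid : ∀ i, IdentDistrib (fun ω => (X i ω, Y i ω)) (fun ω => (X 0 ω, Y 0 ω)) μ μ)
    (hat : ∀ t : ℝ, μ {ω | Y 0 ω = t} = 0)
    (hpos : ∀ g : Fin K, ∀ᵐ ω ∂μ, ∃ p : ℝ, 0 < p ∧ Tendsto (fun N : ℕ =>
      (groupCount (fun i : Fin N => X i ω) g : ℝ) / (N : ℝ)) atTop (𝓝 p)) :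
    mutualInfo (μ.map (fun ω => (X 0 ω, Y 0 ω))) ≠ ⊤ ∧
      TendstoInMeasure μ
        (fun (N : ℕ) ω => estimator (fun i : Fin N => X i ω) (fun i : Fin N => Y i ω) (m N))
        atTop (fun _ => (mutualInfo (μ.map (fun ω => (X 0 ω, Y 0 ω)))).toReal) := by
  have hm0 : Measurable fun ω => (X 0 ω, Y 0 ω) := (hX 0).prodMk (hY 0)
  set ρ := μ.map fun ω => (X 0 ω, Y 0 ω) with hρ
  have hρp : IsProbabilityMeasure ρ := Measure.isProbabilityMeasure_map hm0.aemeasurable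
  have hcount : ∀ g, ∀ᵐ ω ∂μ, Tendsto (fun N : ℕ =>
      (groupCount (fun i : Fin N => X i ω) g : ℝ) / (N : ℝ)) atTop
        (𝓝 (ρ.real (Prod.fst ⁻¹' {g}))) := by
    intro g
    have hgm : MeasurableSet (Prod.fst ⁻¹' {g} : Set (Fin K × ℝ)) :=
      measurable_fst (measurableSet_singleton g)
    have h := ae_tendsto_average hX hY hind hid
      (F := (Prod.fst ⁻¹' {g} : Set (Fin K × ℝ)).indicator 1) (measurable_one.indicator hgm)
      ((integrable_const (1:ℝ)).indicator hgm)
    rw [← hρ, integral_indicator_one hgm] at h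
    filter_upwards [h] with ω hω
    refine hω.congr fun N => ?_
    congr 1
    rw [groupCount, Finset.card_filter, Nat.cast_sum]
    refine Finset.sum_congr rfl fun i _ => ?_
    by_cases hi : X i ω = g
    · rw [Set.indicator_of_mem (by exact hi)]; simp [hi]
    · rw [Set.indicator_of_notMem (by exact hi)]; simp [hi]
  -- The assumed positive limit may depend on `ω`; the strong law identifies it with the probability
  -- of the category.
  have hp : ∀ g, 0 < ρ.real (Prod.fst ⁻¹' {g}) := fun g => by
    obtain ⟨ω, h1, p, hp, h2⟩ := ((hcount g).and (hpos g)).exists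
    rwa [tendsto_nhds_unique h1 h2]
  have hp1 : ∑ g, ρ.real (Prod.fst ⁻¹' {g}) = 1 := by
    obtain ⟨ω, hω⟩ := (ae_all_iff.mpr hcount).exists
    exact sum_eq_one_of_tendsto (x := fun N (i : Fin N) => X i ω) hω
  obtain ⟨ν, hν, hνρ⟩ := exists_jointLaw_eq ρ hp
  set p : Fin K → ℝ := fun g => ρ.real (Prod.fst ⁻¹' {g}) with hpdef
  obtain ⟨f, hf⟩ := exists_isPosterior p ν
  have hlaw : ∀ i, μ.map (fun ω => (X i ω, Y i ω)) = jointLaw p ν := fun i => by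
    rw [(hid i).map_eq, hνρ]
  obtain ⟨hfin, hval⟩ := hf.mutualInfo_jointLaw hp hp1
  rw [hνρ] at hfin hval
  refine ⟨hfin, ?_⟩
  rw [hval]
  have hmN' : ∀ᶠ N in atTop, m N ≤ N := by
    filter_upwards [hmN.eventually (gt_mem_nhds one_pos), eventually_ge_atTop 1] with N hN hN1
    rw [div_lt_one (by exact_mod_cast hN1)] at hN
    exact_mod_cast hN.le
  refine tendstoInMeasure_estimator m hm hmN' hf hp hp1 (fun N ω i => X i ω) (fun N ω i => Y i ω)
    (fun N => measurable_pi_iff.mpr fun i => hX i)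
    (fun N => measurable_pi_iff.mpr fun i => hY i) (fun N => ?_) hcount ?_ ?_
  · refine ae_injective (fun i => hY i) (fun i j hij => ?_) fun i t => ?_
    · exact (hind.indepFun (fun h => hij (Fin.val_injective h))).comp measurable_snd measurable_snd
    · rw [← hat t]
      exact ((hid i).comp measurable_snd).measure_mem_eq (measurableSet_singleton t)
  · intro ψ hψ hψ2
    have hF : Measurable fun z : Fin K × ℝ => ψ z.1 z.2 := measurable_from_prod_countable_right hψ
    have hi : ∀ g, Integrable (fun y => ψ g y) (ν g) := fun g => (hψ2 g).integrable (by norm_num)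
    have h := ae_tendsto_average hX hY hind hid hF
      (by rw [← hρ, ← hνρ]; exact integrable_jointLaw hF hi)
    rw [← hρ, ← hνρ, integral_jointLaw hp hF hi] at h
    refine tendstoInMeasure_of_tendsto_ae (fun N => ?_) h
    refine Measurable.aestronglyMeasurable (Measurable.div_const ?_ _)
    exact Finset.measurable_fun_sum _ fun i _ => hF.comp ((hX i).prodMk (hY i))
  · intro δ hδ
    obtain ⟨η, hη, hη1, hηN⟩ := exists_mul_log_le K hmN hδ
    have := isProbabilityMeasure_mixture (ν := ν) hp hp1
    filter_upwards [hηN, hm.eventually_ge_atTop 1] with N hN1 hN3 I hI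
    have hmeas : ∀ x : Fin N → Fin K, Measurable fun y : Fin N → ℝ => ENNReal.ofReal (Real.exp
        (condLogLik (cellLabel I y) x - logPosterior f x y)) := fun x =>
      (Real.measurable_exp.comp ((measurable_condLogLik_right I x).sub
        ((measurable_sum_apply hf.measurable_log).comp
          (measurable_const.prodMk measurable_id)))).ennreal_ofReal
    rw [lintegral_eq_sum_pi hX hY hind hlaw (fun x y => ENNReal.ofReal (Real.exp
        (condLogLik (cellLabel I y) x - logPosterior f x y))) hmeas]
    -- The expectation over random categories is itself the sum over labelings, so the bound on
    -- types applies without a multinomial factor.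
    calc _ ≤ ∑ x : Fin N → Fin K, ∫⁻ y, ENNReal.ofReal (Real.exp
          (condLogLik (cellLabel I y) x)) ∂(Measure.pi fun _ : Fin N => mixture p ν) :=
          Finset.sum_le_sum fun x _ =>
            hf.lintegral_exp_sub_logPosterior_le hp hp1 x (measurable_condLogLik_right I x)
      _ ≤ ENNReal.ofReal (Real.exp (K * (η * N + m N * Real.log (1 / η)))) :=
          sum_lintegral_condLogLik_le _ hN3 hI hη hη1
      _ ≤ _ := ENNReal.ofReal_le_ofReal (Real.exp_le_exp.mpr hN1)

end RandomCategories

end KSample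

/-- Consistency of `S_m / (N * (N - 1).choose (m - 1))` as an estimator of the mutual information,
both for independent draws from a joint distribution of `(X, Y)` and for `K` independent samples of
prescribed sizes. -/
theorem theorem3 {K : ℕ} (hK : 2 ≤ K)
    {Ω : Type*} [MeasurableSpace Ω] (μ : Measure Ω) [IsProbabilityMeasure μ]
    (m : ℕ → ℕ) (hm : Tendsto m atTop atTop)
    (hmN : Tendsto (fun N : ℕ => (m N : ℝ) / (N : ℝ)) atTop (𝓝 0)) :
    -- independent draws `(X i, Y i)` from a joint distribution
    (∀ (X : ℕ → Ω → Fin K) (Y : ℕ → Ω → ℝ),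
      (∀ i, Measurable (X i)) → (∀ i, Measurable (Y i)) →
      iIndepFun (fun i ω => (X i ω, Y i ω)) μ →
      (∀ i, IdentDistrib (fun ω => (X i ω, Y i ω)) (fun ω => (X 0 ω, Y 0 ω)) μ μ) →
      (∀ t : ℝ, μ {ω | Y 0 ω = t} = 0) →
      (∀ g : Fin K, ∀ᵐ ω ∂μ, ∃ p : ℝ, 0 < p ∧
        Tendsto (fun N : ℕ =>
          (KSample.groupCount (fun i : Fin N => X i ω) g : ℝ) / (N : ℝ)) atTop (𝓝 p)) →
      KSample.mutualInfo (μ.map (fun ω => (X 0 ω, Y 0 ω))) ≠ ⊤ ∧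
      TendstoInMeasure μ
        (fun (N : ℕ) ω => KSample.estimator (fun i : Fin N => X i ω) (fun i : Fin N => Y i ω) (m N))
        atTop
        (fun _ => (KSample.mutualInfo (μ.map (fun ω => (X 0 ω, Y 0 ω)))).toReal)) ∧
    -- for each `N`, independent observations with prescribed categories `x N i`,
    -- where an observation of category `g` has distribution `ν g`
    (∀ (ν : Fin K → Measure ℝ) (x : (N : ℕ) → Fin N → Fin K) (Y : (N : ℕ) → Fin N → Ω → ℝ)
        (p : Fin K → ℝ),
      (∀ g, IsProbabilityMeasure (ν g)) → (∀ (g : Fin K) (t : ℝ), ν g {t} = 0) →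
      (∀ N i, Measurable (Y N i)) →
      (∀ N, iIndepFun (Y N) μ) →
      (∀ N i, μ.map (Y N i) = ν (x N i)) →
      (∀ g, 0 < p g) →
      (∀ g, Tendsto (fun N : ℕ => (KSample.groupCount (x N) g : ℝ) / (N : ℝ)) atTop (𝓝 (p g))) →
      KSample.mutualInfo (KSample.jointLaw p ν) ≠ ⊤ ∧
      TendstoInMeasure μ
        (fun (N : ℕ) ω => KSample.estimator (x N) (fun i : Fin N => Y N i ω) (m N))
        atTop
        (fun _ => (KSample.mutualInfo (KSample.jointLaw p ν)).toReal)) := by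
  exact ⟨fun X Y hX hY hind hid hat hpos =>
      KSample.consistency_draws m hm hmN hX hY hind hid hat hpos,
    fun ν x Y p hν hat hY hind hlaw hp h =>
      KSample.consistency_prescribed m hm hmN hat hY hind hlaw hp h⟩
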